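/- **Proposition.** Let $n\ge 2$. Let $P=\mathbb Z^n/\mathbb Z(1,\dots,1)$ be the weight lattice of $SL_n$, with coordinates indexed by $\mathbb Z/n\mathbb Z$. For $i\in\mathbb Z/n\mathbb Z$ let $\alpha_i=\varepsilon_i-\varepsilon_{i+1}$ be the image of the $i$-th affine simple root (so $\alpha_0=-\theta$, where $\theta$ is the highest root), put $\langle\lambda,\alpha_i^\vee\rangle=\lambda_i-\lambda_{i+1}$ and $r_i\cdot\lambda=\lambda-\langle\lambda,\alpha_i^\vee\rangle\alpha_i$, and let $S=\mathrm{Sym}_{\mathbb Z}(P)$. Let $W_{\mathrm{aff}}$ be the affine symmetric group, that is, the Coxeter group of type $\widetilde A_{n-1}$ with simple reflections $r_i$ ($i\in\mathbb Z/n\mathbb Z$) and length function $\ell$. Let $\mathbb A$ be the affine nilHecke ring: the ring with $1$ generated by $A_i$ ($i\in\mathbb Z/n\mathbb Z$) and by the commuting scalars $\lambda\in P$ (additive in $\lambda$), with relations $A_i\lambda=(r_i\cdot\lambda)A_i+\langle\lambda,\alpha_i^\vee\rangle$, $A_i^2=0$, and the braid relations of $W_{\mathrm{aff}}$ for the $A_i$.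 It is a left $S$-module. For $w\in W_{\mathrm{aff}}$ put $A_w=A_{i_1}\cdots A_{i_l}$ for any reduced decomposition $w=r_{i_1}\cdots r_{i_l}$; the $A_w$ form an $S$-basis of $\mathbb A$. Let $\mathbb A_0\subset\mathbb A$ be the subring generated by the $A_i$. Let $\phi_0$ denote the specialization maps $\mathbb A\to\mathbb A_0$, $\sum_w a_wA_w\mapsto\sum_w a_w(0)A_w$, and $\mathbb A\otimes_S\mathbb A\to\mathbb A_0\otimes_{\mathbb Z}\mathbb A_0$, $\sum_{w,v}a_{w,v}A_w\otimes A_v\mapsto\sum_{w,v}a_{w,v}(0)A_w\otimes A_v$. The ring $\mathbb A$ acts on $\mathbb A\otimes_S\mathbb A$ (both factors regarded as left $S$-modules) by $s\cdot(x\otimes y)=sx\otimes y$ for $s\in S$ and $A_i\cdot(x\otimes y)=A_ix\otimes y+(1-\alpha_iA_i)x\otimes A_iy$. The coproduct $\Delta:\mathbb A\to\mathbb A\otimes_S\mathbb A$ is $\Delta(a)=a\cdot(1\otimes1)$. Call $w\in W_{\mathrm{aff}}$ cyclically decreasing if $w=r_{a_1}\cdots r_{a_k}$ for a word $a_1\cdots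 a_k$ of distinct letters of $\mathbb Z/n\mathbb Z$ in which $i+1$ precedes $i$ whenever both occur. For $0\le i\le n-1$ let $h_i=\sum_w A_w$ be the sum over all cyclically decreasing $w$ with $\ell(w)=i$, and let $\mathbb B\subset\mathbb A_0$ be the subalgebra generated by $h_0,\dots,h_{n-1}$. Then there is a unique ring homomorphism $\Delta_{\mathbb B}:\mathbb B\to\mathbb B\otimes_{\mathbb Z}\mathbb B$ such that $\Delta_{\mathbb B}(h_i)=\sum_{0\le j\le i}h_j\otimes h_{i-j}$ for $0\le i\le n-1$, and $$\phi_0(\Delta(b))=\Delta_{\mathbb B}(b)\qquad\text{in }\mathbb A_0\otimes_{\mathbb Z}\mathbb A_0,\ \text{ for all } b\in\mathbb B .$$ -/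

import Mathlib

open scoped TensorProduct

namespace AffineFS

/-- The weight lattice of `SL_n`: `ℤ^n` modulo the constant vectors, coordinates indexed by `ℤ/n`. -/
abbrev Weight (n : ℕ) : Type := (ZMod n → ℤ) ⧸ Submodule.span ℤ {(1 : ZMod n → ℤ)}

/-- The image in the weight lattice of the affine simple root `α_i = ε_i - ε_{i+1}`, `i ∈ ℤ/n`.
In particular `α_0 = ε_n - ε_1 = -θ`, as the null root maps to zero. -/
def root {n : ℕ} (i : ZMod n) : Weight n :=
  Submodule.Quotient.mk (Pi.single i 1 - Pi.single (i + 1) 1)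

/-- The pairing `λ ↦ ⟨λ, α_i^∨⟩ = λ_i - λ_{i+1}` with the affine simple coroot. -/
def coroot {n : ℕ} (i : ZMod n) : Weight n →ₗ[ℤ] ℤ :=
  Submodule.liftQ _ ((LinearMap.proj i : (ZMod n → ℤ) →ₗ[ℤ] ℤ) - LinearMap.proj (i + 1)) (by
    rw [Submodule.span_le]; simp)

/-- The simple reflection `r_i · λ = λ - ⟨λ, α_i^∨⟩ α_i`. -/
def refl {n : ℕ} (i : ZMod n) : Weight n →ₗ[ℤ] Weight n :=
  LinearMap.id - (coroot i).smulRight (root i)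

theorem refl_apply {n : ℕ} (i : ZMod n) (l : Weight n) :
    refl i l = l - coroot i l • root i := rfl

/-- The Coxeter matrix of type affine `A_{n-1}`; an entry `0` means that there is no relation. -/
def coxMatrix (n : ℕ) : CoxeterMatrix (ZMod n) where
  M := Matrix.of fun i j =>
    if i = j then 1 else if n = 2 then 0 else if j = i + 1 ∨ i = j + 1 then 3 else 2
  isSymm := by
    ext i j
    simp only [Matrix.transpose_apply, Matrix.of_apply, eq_comm (a := i) (b := j), or_comm]
  diagonal := by simp
  off_diagonal := by
    intro i j h
    simp only [Matrix.of_apply, if_neg h]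
    split_ifs <;> decide

/-- The affine symmetric group, as a Coxeter group. -/
abbrev Waff (n : ℕ) : Type := (coxMatrix n).Group

/-- The standard Coxeter system on the affine symmetric group. -/
def cs (n : ℕ) : CoxeterSystem (coxMatrix n) (Waff n) := (coxMatrix n).toCoxeterSystem

/-- The defining relations of the affine nilHecke ring; `Sum.inl i` stands for `A_i` and
`Sum.inr l` for the scalar `l`. -/
inductive NilHeckeRel (n : ℕ) : FreeRing (ZMod n ⊕ Weight n) → FreeRing (ZMod n ⊕ Weight n) → Prop
  | scalar_add (l m : Weight n) : NilHeckeRel n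
      (FreeRing.of (Sum.inr (l + m))) (FreeRing.of (Sum.inr l) + FreeRing.of (Sum.inr m))
  | scalar_comm (l m : Weight n) : NilHeckeRel n
      (FreeRing.of (Sum.inr l) * FreeRing.of (Sum.inr m))
      (FreeRing.of (Sum.inr m) * FreeRing.of (Sum.inr l))
  | leibniz (i : ZMod n) (l : Weight n) : NilHeckeRel n
      (FreeRing.of (Sum.inl i) * FreeRing.of (Sum.inr l))
      (FreeRing.of (Sum.inr (refl i l)) * FreeRing.of (Sum.inl i) +
        ((coroot i l : ℤ) : FreeRing (ZMod n ⊕ Weight n)))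
  | nil (i : ZMod n) : NilHeckeRel n
      (FreeRing.of (Sum.inl i) * FreeRing.of (Sum.inl i)) 0
  | comm (i j : ZMod n) (h : coxMatrix n i j = 2) : NilHeckeRel n
      (FreeRing.of (Sum.inl i) * FreeRing.of (Sum.inl j))
      (FreeRing.of (Sum.inl j) * FreeRing.of (Sum.inl i))
  | braid (i j : ZMod n) (h : coxMatrix n i j = 3) : NilHeckeRel n
      (FreeRing.of (Sum.inl i) * FreeRing.of (Sum.inl j) * FreeRing.of (Sum.inl i))
      (FreeRing.of (Sum.inl j) * FreeRing.of (Sum.inl i) * FreeRing.of (Sum.inl j))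

/-- The affine nilHecke ring of type `A_{n-1}`. -/
def NilHecke (n : ℕ) : Type := RingQuot (NilHeckeRel n)

noncomputable instance (n : ℕ) : Ring (NilHecke n) :=
  inferInstanceAs (Ring (RingQuot (NilHeckeRel n)))

/-- The quotient map from the free ring. -/
noncomputable def NilHecke.mk (n : ℕ) : FreeRing (ZMod n ⊕ Weight n) →+* NilHecke n :=
  RingQuot.mkRingHom (NilHeckeRel n)

theorem NilHecke.mk_rel {n : ℕ} {x y : FreeRing (ZMod n ⊕ Weight n)} (h : NilHeckeRel n x y) :
    NilHecke.mk n x = NilHecke.mk n y :=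
  RingQuot.mkRingHom_rel h

theorem NilHecke.mk_surjective (n : ℕ) : Function.Surjective (NilHecke.mk n) :=
  RingQuot.mkRingHom_surjective _

/-- The generator `A_i`. -/
noncomputable def gen {n : ℕ} (i : ZMod n) : NilHecke n :=
  NilHecke.mk n (FreeRing.of (Sum.inl i))

/-- The degree one scalar in the nilHecke ring given by a weight. -/
noncomputable def wt {n : ℕ} (l : Weight n) : NilHecke n :=
  NilHecke.mk n (FreeRing.of (Sum.inr l))

section
variable {n : ℕ}

theorem wt_add (l m : Weight n) : wt (l + m) = wt l + wt m := by
  have := NilHecke.mk_rel (NilHeckeRel.scalar_add l m)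
  simpa only [gen, wt, map_add] using this

theorem wt_comm (l m : Weight n) : wt l * wt m = wt m * wt l := by
  have := NilHecke.mk_rel (NilHeckeRel.scalar_comm l m)
  simpa only [gen, wt, map_mul] using this

theorem gen_wt (i : ZMod n) (l : Weight n) :
    gen i * wt l = wt (refl i l) * gen i + (coroot i l : ℤ) := by
  have := NilHecke.mk_rel (NilHeckeRel.leibniz i l)
  simpa only [gen, wt, map_mul, map_add, map_intCast] using this

theorem gen_sq (i : ZMod n) : gen i * gen i = 0 := by
  have := NilHecke.mk_rel (NilHeckeRel.nil i)
  simpa only [gen, wt, map_mul, map_zero] using this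

theorem gen_comm (i j : ZMod n) (h : coxMatrix n i j = 2) : gen i * gen j = gen j * gen i := by
  have := NilHecke.mk_rel (NilHeckeRel.comm i j h)
  simpa only [gen, wt, map_mul] using this

theorem gen_braid (i j : ZMod n) (h : coxMatrix n i j = 3) :
    gen i * gen j * gen i = gen j * gen i * gen j := by
  have := NilHecke.mk_rel (NilHeckeRel.braid i j h)
  simpa only [gen, wt, map_mul] using this

/-- The universal property of the presentation. -/
noncomputable def NilHecke.lift {R : Type*} [Ring R] (f : ZMod n → R) (g : Weight n → R)
    (h_add : ∀ l m, g (l + m) = g l + g m) (h_comm : ∀ l m, g l * g m = g m * g l)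
    (h_leibniz : ∀ i l, f i * g l = g (refl i l) * f i + (coroot i l : ℤ))
    (h_nil : ∀ i, f i * f i = 0)
    (h_c : ∀ i j, coxMatrix n i j = 2 → f i * f j = f j * f i)
    (h_b : ∀ i j, coxMatrix n i j = 3 → f i * f j * f i = f j * f i * f j) : NilHecke n →+* R :=
  RingQuot.lift ⟨FreeRing.lift (Sum.elim f g), by
    intro x y h
    induction h with
    | scalar_add l m => simpa using h_add l m
    | scalar_comm l m => simpa using h_comm l m
    | leibniz i l => simpa using h_leibniz i l
    | nil i => simpa using h_nil i
    | comm i j h => simpa using h_c i j h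
    | braid i j h => simpa using h_b i j h⟩

theorem NilHecke.lift_gen {R : Type*} [Ring R] (f : ZMod n → R) (g : Weight n → R)
    (h1 h2 h3 h4 h5 h6) (i : ZMod n) : NilHecke.lift f g h1 h2 h3 h4 h5 h6 (gen i) = f i := by
  refine (RingQuot.lift_mkRingHom_apply _ _ _).trans ?_
  simp

theorem NilHecke.lift_wt {R : Type*} [Ring R] (f : ZMod n → R) (g : Weight n → R)
    (h1 h2 h3 h4 h5 h6) (l : Weight n) : NilHecke.lift f g h1 h2 h3 h4 h5 h6 (wt l) = g l := by
  refine (RingQuot.lift_mkRingHom_apply _ _ _).trans ?_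
  simp

/-- `wt` as an additive map -/
noncomputable def wtHom (n : ℕ) : Weight n →ₗ[ℤ] NilHecke n :=
  (AddMonoidHom.mk' (wt (n := n)) wt_add).toIntLinearMap

end

/-- The ring of scalars `S = Sym(h_ℤ^*)`. -/
abbrev Scalars (n : ℕ) : Type := SymmetricAlgebra ℤ (Weight n)

/-- Evaluation of a polynomial in `S` at `0`. -/
noncomputable def evalZero (n : ℕ) : Scalars n →ₐ[ℤ] ℤ := SymmetricAlgebra.lift 0

/-- The ring homomorphism `S → A_aff`. -/
noncomputable def scalar (n : ℕ) : Scalars n →+* NilHecke n :=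
  RingCon.lift (TensorAlgebra.symRingCon ℤ (Weight n))
    (TensorAlgebra.lift ℤ (wtHom n)).toRingHom (RingCon.ringConGen_le.2 (by
      rintro x y ⟨l, m⟩
      simpa [RingCon.ker_apply, wtHom] using wt_comm l m))

theorem scalar_ι {n : ℕ} (l : Weight n) : scalar n (SymmetricAlgebra.ι ℤ _ l) = wt l := by
  change (TensorAlgebra.lift ℤ (wtHom n)) (TensorAlgebra.ι ℤ l) = _
  simp [wtHom]

/-- `A_aff` as a left `S`-module. -/
noncomputable instance (n : ℕ) : Module (Scalars n) (NilHecke n) :=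
  Module.compHom (NilHecke n) (scalar n)

theorem smul_def {n : ℕ} (s : Scalars n) (a : NilHecke n) : s • a = scalar n s * a := rfl

theorem ι_smul {n : ℕ} (l : Weight n) (a : NilHecke n) :
    SymmetricAlgebra.ι ℤ (Weight n) l • a = wt l * a := by
  rw [smul_def, scalar_ι]

/-! ### Cartan integers -/

section
variable {n : ℕ}

theorem coroot_root (i j : ZMod n) : coroot i (root j) =
    (if i = j then 1 else 0) - (if i = j + 1 then 1 else 0)
      - ((if i + 1 = j then 1 else 0) - (if i = j then 1 else 0)) := by
  simp only [coroot, root, Submodule.liftQ_apply, LinearMap.sub_apply, LinearMap.proj_apply,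
    Pi.sub_apply, Pi.single_apply, add_left_inj]

theorem one_ne_zero' [n.AtLeastTwo] : (1 : ZMod n) ≠ 0 := by
  have : Fact (1 < n) := ⟨Nat.AtLeastTwo.prop⟩
  exact one_ne_zero

theorem two_ne_zero' [n.AtLeastTwo] (h : n ≠ 2) : (2 : ZMod n) ≠ 0 := by
  have h2 : 2 ≤ n := Nat.AtLeastTwo.prop
  intro h0
  have : ((2 : ℕ) : ZMod n) = 0 := by exact_mod_cast h0
  rw [ZMod.natCast_eq_zero_iff] at this
  have := Nat.le_of_dvd (by norm_num) this
  omega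

theorem coroot_root_self [n.AtLeastTwo] (i : ZMod n) : coroot i (root i) = 2 := by
  rw [coroot_root]
  simp [one_ne_zero' (n := n)]

theorem cartan_of_two (i j : ZMod n) (h : coxMatrix n i j = 2) :
    coroot i (root j) = 0 ∧ coroot j (root i) = 0 := by
  have h' : i ≠ j ∧ ¬ (j = i + 1 ∨ i = j + 1) := by
    change (if i = j then 1 else if n = 2 then 0 else if j = i + 1 ∨ i = j + 1 then 3 else 2) = 2 at h
    split_ifs at h with h1 h2 h3
    all_goals first | exact absurd h (by decide) | exact ⟨h1, h3⟩
  obtain ⟨h1, h3⟩ := h'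
  push Not at h3
  rw [coroot_root, coroot_root]
  simp [h1, h1.symm, h3.1, h3.2, h3.1.symm, h3.2.symm]

theorem cartan_of_three [n.AtLeastTwo] (i j : ZMod n) (h : coxMatrix n i j = 3) :
    coroot i (root j) = -1 ∧ coroot j (root i) = -1 := by
  change (if i = j then 1 else if n = 2 then 0 else if j = i + 1 ∨ i = j + 1 then 3 else 2) = 3 at h
  have h0 : n ≠ 2 ∧ (j = i + 1 ∨ i = j + 1) := by
    split_ifs at h with h1 h2 h3
    all_goals first | exact absurd h (by decide) | exact ⟨h2, h3⟩
  obtain ⟨h2, h3⟩ := h0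
  have h4 := two_ne_zero' h2
  have h5 : ∀ k : ZMod n, k + 1 + 1 ≠ k := by
    intro k hk
    exact h4 (by linear_combination hk)
  have h6 : ∀ k : ZMod n, k ≠ k + 1 + 1 := fun k => (h5 k).symm
  rw [coroot_root, coroot_root]
  rcases h3 with rfl | rfl <;> simp [h5, h6, one_ne_zero' (n := n)]

theorem refl_root (i j : ZMod n) : refl i (root j) = root j - coroot i (root j) • root i := rfl

theorem wt_sub (l m : Weight n) : wt (l - m) = wt l - wt m := (wtHom n).map_sub l m
theorem wt_neg (l : Weight n) : wt (-l) = -wt l := (wtHom n).map_neg l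
theorem wt_zsmul (c : ℤ) (l : Weight n) : wt (c • l) = (c : NilHecke n) * wt l := by
  rw [← zsmul_eq_mul]; exact (wtHom n).map_smul c l
theorem wt_zero : wt (0 : Weight n) = 0 := (wtHom n).map_zero

theorem gen_root_self [n.AtLeastTwo] (i : ZMod n) :
    gen i * wt (root i) = - (wt (root i) * gen i) + 2 := by
  rw [gen_wt, refl_root, coroot_root_self, wt_sub, wt_zsmul]
  push_cast
  noncomm_ring

theorem gen_root_comm (i j : ZMod n) (h : coxMatrix n i j = 2) :
    gen i * wt (root j) = wt (root j) * gen i := by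
  rw [gen_wt, refl_root, (cartan_of_two i j h).1]
  simp

theorem gen_root_braid [n.AtLeastTwo] (i j : ZMod n) (h : coxMatrix n i j = 3) :
    gen i * wt (root j) = (wt (root j) + wt (root i)) * gen i - 1 := by
  rw [gen_wt, refl_root, (cartan_of_three i j h).1, wt_sub, wt_zsmul]
  push_cast
  noncomm_ring

end

/-! ### The coproduct -/

section
variable {n : ℕ}

/-- The image `r_i = 1 - α_i A_i` of a simple reflection in the nilHecke ring. -/
noncomputable def simpleRefl (i : ZMod n) : NilHecke n := 1 - wt (root i) * gen i

theorem simpleRefl_wt [n.AtLeastTwo] (i : ZMod n) (l : Weight n) :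
    simpleRefl i * wt l = wt (refl i l) * simpleRefl i := by
  rw [simpleRefl, sub_mul, mul_assoc, gen_wt, mul_add, ← mul_assoc, wt_comm (root i), refl_apply,
    mul_sub, wt_sub, wt_zsmul, Int.cast_comm]
  noncomm_ring

set_option linter.unusedSimpArgs false in
/-- Consequences of the relations between `A_i`, `A_j` and the roots `α_i`, `α_j`. -/
theorem braid_aux {R : Type*} [Ring R] (a b x y : R) (hxy : y * x = x * y)
    (haa : a * a = 0) (hbb : b * b = 0) (hab : b * a * b = a * b * a)
    (hax : a * x = -(x * a) + 2) (hby : b * y = -(y * b) + 2)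
    (hay : a * y = (y + x) * a - 1) (hbx : b * x = (x + y) * b - 1) :
    (1 - x * a) * b * a + a * b * (1 - x * a) = b * (1 - x * a) * b ∧
    (1 - x * a) * (1 - y * b) * a = b * (1 - x * a) * (1 - y * b) ∧
    (1 - x * a) * (1 - y * b) * (1 - x * a) = (1 - y * b) * (1 - x * a) * (1 - y * b) := by
  have hxy' : ∀ z, y * (x * z) = x * (y * z) := fun z => by rw [← mul_assoc, hxy, mul_assoc]
  have haa' : ∀ z, a * (a * z) = 0 := fun z => by rw [← mul_assoc, haa, zero_mul]
  have hbb' : ∀ z, b * (b * z) = 0 := fun z => by rw [← mul_assoc, hbb, zero_mul]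
  have hab1 : b * (a * b) = a * (b * a) := by rw [← mul_assoc, hab, mul_assoc]
  have hab' : ∀ z, b * (a * (b * z)) = a * (b * (a * z)) := fun z => by
    rw [← mul_assoc, ← mul_assoc, hab, mul_assoc, mul_assoc]
  have hax' : ∀ z, a * (x * z) = -(x * (a * z)) + 2 * z := fun z => by
    rw [← mul_assoc, hax]; noncomm_ring
  have hby' : ∀ z, b * (y * z) = -(y * (b * z)) + 2 * z := fun z => by
    rw [← mul_assoc, hby]; noncomm_ring
  have hay' : ∀ z, a * (y * z) = y * (a * z) + x * (a * z) - z := fun z => by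
    rw [← mul_assoc, hay]; noncomm_ring
  have hbx' : ∀ z, b * (x * z) = x * (b * z) + y * (b * z) - z := fun z => by
    rw [← mul_assoc, hbx]; noncomm_ring
  rw [add_mul] at hay hbx
  refine ⟨?_, ?_, ?_⟩ <;>
  · simp only [mul_sub, sub_mul, mul_add, add_mul, mul_one, one_mul, mul_assoc, mul_neg, haa, hbb,
      two_mul, hab1, hax, hby, hay, hbx, hxy', haa', hbb', hab', hax', hby', hay', hbx', mul_zero]
    abel

/-- The action of `A_i` on a pair `(x, y)`, before passing to the tensor product over `S`. -/
noncomputable def coprodPre (i : ZMod n) :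
    NilHecke n →+ NilHecke n →+ NilHecke n ⊗[Scalars n] NilHecke n :=
  AddMonoidHom.mk' (fun x => AddMonoidHom.mk' (fun y =>
      (gen i * x) ⊗ₜ[Scalars n] y + (simpleRefl i * x) ⊗ₜ[Scalars n] (gen i * y))
    (by intro y z; simp only [mul_add, TensorProduct.tmul_add]; abel))
    (by
      intro x z; ext y
      simp only [AddMonoidHom.mk'_apply, AddMonoidHom.add_apply, mul_add, TensorProduct.add_tmul]
      abel)

theorem wt_tmul (l : Weight n) (x y : NilHecke n) :
    (wt l * x) ⊗ₜ[Scalars n] y = SymmetricAlgebra.ι ℤ (Weight n) l • (x ⊗ₜ[Scalars n] y) := by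
  rw [TensorProduct.smul_tmul', ι_smul]

theorem tmul_wt (l : Weight n) (x y : NilHecke n) :
    x ⊗ₜ[Scalars n] (wt l * y) = SymmetricAlgebra.ι ℤ (Weight n) l • (x ⊗ₜ[Scalars n] y) := by
  rw [← TensorProduct.tmul_smul, ι_smul]

theorem zsmul_smul_tensor (c : ℤ) (s : Scalars n) (t : NilHecke n ⊗[Scalars n] NilHecke n) :
    (c • s) • t = c • (s • t) := by
  rw [zsmul_eq_mul, mul_smul, Int.cast_smul_eq_zsmul]

theorem tensor_addHom_ext {P : Type*} [AddCommGroup P]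
    {f g : NilHecke n ⊗[Scalars n] NilHecke n →+ P}
    (h : ∀ x y, f (x ⊗ₜ[Scalars n] y) = g (x ⊗ₜ[Scalars n] y)) : f = g := by
  ext t
  induction t using TensorProduct.induction_on with
  | zero => rw [map_zero, map_zero]
  | tmul x y => exact h x y
  | add x y hx hy => rw [map_add, map_add, hx, hy]

theorem tensor_end_ext {f g : AddMonoid.End (NilHecke n ⊗[Scalars n] NilHecke n)}
    (h : ∀ x y, f (x ⊗ₜ[Scalars n] y) = g (x ⊗ₜ[Scalars n] y)) : f = g :=
  tensor_addHom_ext h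

theorem coprodPre_wt [n.AtLeastTwo] (i : ZMod n) (l : Weight n) (x y : NilHecke n) :
    coprodPre i (wt l * x) y =
      SymmetricAlgebra.ι ℤ (Weight n) (refl i l) • coprodPre i x y
        + coroot i l • (x ⊗ₜ[Scalars n] y) := by
  simp only [coprodPre, AddMonoidHom.mk'_apply]
  rw [← mul_assoc, ← mul_assoc, gen_wt, simpleRefl_wt, add_mul, mul_assoc, mul_assoc,
    TensorProduct.add_tmul, wt_tmul, wt_tmul, smul_add, ← zsmul_eq_mul, ← TensorProduct.smul_tmul']
  abel

theorem coprodPre_balanced [n.AtLeastTwo] (i : ZMod n) (s : Scalars n) (x y : NilHecke n) :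
    coprodPre i (s • x) y = coprodPre i x (s • y) := by
  induction s using SymmetricAlgebra.induction generalizing x y with
  | algebraMap r =>
    rw [algebraMap_smul, algebraMap_smul, map_zsmul, map_zsmul, AddMonoidHom.smul_apply]
  | ι l =>
    rw [ι_smul, ι_smul, coprodPre_wt]
    simp only [coprodPre, AddMonoidHom.mk'_apply]
    rw [tmul_wt, ← mul_assoc (gen i) (wt l), gen_wt, add_mul, TensorProduct.tmul_add, mul_assoc,
      tmul_wt, ← zsmul_eq_mul, TensorProduct.tmul_smul, smul_add]
    have h1 : simpleRefl i * x = x - wt (root i) * (gen i * x) := by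
      rw [simpleRefl, sub_mul, one_mul, mul_assoc]
    have h2 : coroot i l • ((simpleRefl i * x) ⊗ₜ[Scalars n] y) = coroot i l • (x ⊗ₜ[Scalars n] y) -
        SymmetricAlgebra.ι ℤ (Weight n) (coroot i l • root i) • ((gen i * x) ⊗ₜ[Scalars n] y) := by
      rw [h1, TensorProduct.sub_tmul, smul_sub, wt_tmul, map_zsmul, zsmul_smul_tensor]
    rw [h2, refl_apply, map_sub, sub_smul]
    abel
  | mul a b ha hb => rw [mul_smul, mul_smul, ha, hb, ← mul_smul, mul_comm, mul_smul]
  | add a b ha hb =>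
    rw [add_smul, add_smul, map_add, map_add, AddMonoidHom.add_apply, ha, hb]

/-- The action of `A_i` on `A_aff ⊗_S A_aff`: `A_i · (x ⊗ y) = A_i x ⊗ y + r_i x ⊗ A_i y`. -/
noncomputable def genAct [n.AtLeastTwo] (i : ZMod n) :
    AddMonoid.End (NilHecke n ⊗[Scalars n] NilHecke n) :=
  TensorProduct.liftAddHom (coprodPre i) (coprodPre_balanced i)

theorem genAct_tmul [n.AtLeastTwo] (i : ZMod n) (x y : NilHecke n) :
    genAct i (x ⊗ₜ[Scalars n] y) =
      (gen i * x) ⊗ₜ[Scalars n] y + (simpleRefl i * x) ⊗ₜ[Scalars n] (gen i * y) := rfl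

/-- The action of a weight on `A_aff ⊗_S A_aff`. -/
noncomputable def wtAct (l : Weight n) : AddMonoid.End (NilHecke n ⊗[Scalars n] NilHecke n) :=
  Module.toAddMonoidEnd (Scalars n) _ (SymmetricAlgebra.ι ℤ (Weight n) l)

/-- The action of `A_aff` on `A_aff ⊗_S A_aff` by which the coproduct is defined. -/
noncomputable def coprodAct (n : ℕ) [n.AtLeastTwo] :
    NilHecke n →+* AddMonoid.End (NilHecke n ⊗[Scalars n] NilHecke n) :=
  NilHecke.lift genAct wtAct
    (fun l m => by rw [wtAct, map_add, map_add]; rfl)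
    (fun l m => by rw [wtAct, wtAct, ← map_mul, mul_comm, map_mul])
    (fun i l => by
      refine tensor_end_ext fun x y => ?_
      change genAct i (SymmetricAlgebra.ι ℤ (Weight n) l • (x ⊗ₜ[Scalars n] y)) =
        SymmetricAlgebra.ι ℤ (Weight n) (refl i l) • genAct i (x ⊗ₜ[Scalars n] y)
          + ((coroot i l : ℤ) : AddMonoid.End (NilHecke n ⊗[Scalars n] NilHecke n))
            (x ⊗ₜ[Scalars n] y)
      rw [← wt_tmul, AddMonoid.End.intCast_apply]
      exact coprodPre_wt i l x y)
    (fun i => by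
      refine tensor_end_ext fun x y => ?_
      change genAct i (genAct i (x ⊗ₜ[Scalars n] y)) = 0
      have h : simpleRefl i * gen i + gen i * simpleRefl i = 0 := by
        rw [simpleRefl, sub_mul, mul_sub, ← mul_assoc, gen_root_self, mul_assoc, gen_sq, add_mul,
          neg_mul, mul_assoc, gen_sq]
        noncomm_ring
      rw [genAct_tmul, map_add, genAct_tmul, genAct_tmul]
      simp only [← mul_assoc, gen_sq, zero_mul, TensorProduct.zero_tmul, TensorProduct.tmul_zero,
        zero_add, add_zero]
      rw [← TensorProduct.add_tmul, ← add_mul, h, zero_mul, TensorProduct.zero_tmul])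
    (fun i j h => by
      refine tensor_end_ext fun x y => ?_
      change genAct i (genAct j (x ⊗ₜ[Scalars n] y)) = genAct j (genAct i (x ⊗ₜ[Scalars n] y))
      have h' : coxMatrix n j i = 2 := by rw [(coxMatrix n).symmetric, h]
      have e1 : gen i * simpleRefl j = simpleRefl j * gen i := by
        rw [simpleRefl, mul_sub, sub_mul, ← mul_assoc, gen_root_comm i j h, mul_assoc,
          gen_comm i j h, mul_one, one_mul, mul_assoc]
      have e2 : gen j * simpleRefl i = simpleRefl i * gen j := by
        rw [simpleRefl, mul_sub, sub_mul, ← mul_assoc, gen_root_comm j i h', mul_assoc,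
          gen_comm j i h', mul_one, one_mul, mul_assoc]
      have e3 : simpleRefl i * simpleRefl j = simpleRefl j * simpleRefl i := by
        rw [simpleRefl, sub_mul, mul_assoc, e1, ← mul_assoc, one_mul]
        conv_rhs => rw [mul_sub, mul_one, ← mul_assoc]
        rw [simpleRefl, sub_mul (1 : NilHecke n), mul_assoc (wt (root j)) (gen j) (wt (root i)),
          gen_root_comm j i h', mul_sub, ← mul_assoc (wt (root j)), wt_comm (root j) (root i)]
        noncomm_ring
      simp only [genAct_tmul, map_add, ← mul_assoc]
      rw [gen_comm i j h, e1, e2, e3]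
      abel)
    (fun i j h => by
      refine tensor_end_ext fun x y => ?_
      change genAct i (genAct j (genAct i (x ⊗ₜ[Scalars n] y))) =
        genAct j (genAct i (genAct j (x ⊗ₜ[Scalars n] y)))
      have h' : coxMatrix n j i = 3 := by rw [(coxMatrix n).symmetric, h]
      obtain ⟨p1, p2, p3⟩ := braid_aux (gen i) (gen j) (wt (root i)) (wt (root j)) (wt_comm _ _)
        (gen_sq i) (gen_sq j) (gen_braid j i h') (gen_root_self i) (gen_root_self j)
        (gen_root_braid i j h) (gen_root_braid j i h')
      obtain ⟨q1, q2, q3⟩ := braid_aux (gen j) (gen i) (wt (root j)) (wt (root i)) (wt_comm _ _)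
        (gen_sq j) (gen_sq i) (gen_braid i j h) (gen_root_self j) (gen_root_self i)
        (gen_root_braid j i h') (gen_root_braid i j h)
      have e : ∀ k : ZMod n, 1 - wt (root k) * gen k = simpleRefl k := fun _ => rfl
      simp only [e] at p1 p2 p3 q1 q2 q3
      simp only [genAct_tmul, map_add, ← mul_assoc, gen_sq, zero_mul,
        TensorProduct.tmul_zero, add_zero]
      rw [gen_braid i j h, p2, p3, ← q1, ← p1, ← q2]
      simp only [add_mul, TensorProduct.add_tmul]
      abel)

theorem coprodAct_gen [n.AtLeastTwo] (i : ZMod n) : coprodAct n (gen i) = genAct i := by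
  rw [coprodAct, NilHecke.lift_gen]

theorem coprodAct_wt [n.AtLeastTwo] (l : Weight n) : coprodAct n (wt l) = wtAct l := by
  rw [coprodAct, NilHecke.lift_wt]

/-- The coproduct `Δ : A_aff → A_aff ⊗_S A_aff`, `Δ(a) = a · (1 ⊗ 1)`. -/
noncomputable def coprod (n : ℕ) [n.AtLeastTwo] :
    NilHecke n →+ NilHecke n ⊗[Scalars n] NilHecke n :=
  AddMonoidHom.mk' (fun a => coprodAct n a (1 ⊗ₜ[Scalars n] 1)) (by
    intro a b; rw [map_add]; rfl)

theorem coprod_gen [n.AtLeastTwo] (i : ZMod n) : coprod n (gen i) =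
    gen i ⊗ₜ[Scalars n] 1 + simpleRefl i ⊗ₜ[Scalars n] gen i := by
  change coprodAct n (gen i) _ = _
  rw [coprodAct_gen, genAct_tmul]
  simp

theorem coprodAct_scalar [n.AtLeastTwo] (s : Scalars n) (t : NilHecke n ⊗[Scalars n] NilHecke n) :
    coprodAct n (scalar n s) t = s • t := by
  induction s using SymmetricAlgebra.induction generalizing t with
  | algebraMap r =>
    rw [eq_intCast (algebraMap ℤ (Scalars n)), map_intCast, map_intCast,
      AddMonoid.End.intCast_apply]
    exact (Int.cast_smul_eq_zsmul (Scalars n) r t).symm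
  | ι l => rw [scalar_ι, coprodAct_wt]; rfl
  | mul a b ha hb => rw [map_mul, map_mul, mul_smul, ← hb, ← ha]; rfl
  | add a b ha hb => rw [map_add, map_add, add_smul, ← hb, ← ha]; rfl

theorem coprod_scalar [n.AtLeastTwo] (s : Scalars n) :
    coprod n (scalar n s) = scalar n s ⊗ₜ[Scalars n] 1 := by
  change coprodAct n (scalar n s) _ = _
  rw [coprodAct_scalar, TensorProduct.smul_tmul', smul_def, mul_one]

theorem coprod_mul [n.AtLeastTwo] (a b : NilHecke n) :
    coprod n (a * b) = coprodAct n a (coprod n b) := by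
  change coprodAct n (a * b) _ = _
  rw [map_mul]; rfl

end

/-! ### The nilCoxeter algebra and the specialization at zero -/

/-- The defining relations of the affine nilCoxeter algebra. -/
inductive NilCoxRel (n : ℕ) : FreeRing (ZMod n) → FreeRing (ZMod n) → Prop
  | nil (i : ZMod n) : NilCoxRel n (FreeRing.of i * FreeRing.of i) 0
  | comm (i j : ZMod n) (h : coxMatrix n i j = 2) : NilCoxRel n
      (FreeRing.of i * FreeRing.of j) (FreeRing.of j * FreeRing.of i)
  | braid (i j : ZMod n) (h : coxMatrix n i j = 3) : NilCoxRel n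
      (FreeRing.of i * FreeRing.of j * FreeRing.of i)
      (FreeRing.of j * FreeRing.of i * FreeRing.of j)

/-- The affine nilCoxeter algebra by generators and relations. It is an auxiliary copy of the
subring of the nilHecke ring generated by the `A_i`. -/
def NilCox (n : ℕ) : Type := RingQuot (NilCoxRel n)

noncomputable instance (n : ℕ) : Ring (NilCox n) := inferInstanceAs (Ring (RingQuot (NilCoxRel n)))

section
variable {n : ℕ}

/-- The quotient map from the free ring. -/
noncomputable def NilCox.mk (n : ℕ) : FreeRing (ZMod n) →+* NilCox n :=
  RingQuot.mkRingHom (NilCoxRel n)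

theorem NilCox.mk_rel {x y : FreeRing (ZMod n)} (h : NilCoxRel n x y) :
    NilCox.mk n x = NilCox.mk n y :=
  RingQuot.mkRingHom_rel h

/-- The generators of `NilCox n`. -/
noncomputable def ngen (i : ZMod n) : NilCox n := NilCox.mk n (FreeRing.of i)

theorem ngen_sq (i : ZMod n) : ngen i * ngen i = 0 := by
  have := NilCox.mk_rel (NilCoxRel.nil i)
  simpa only [ngen, map_mul, map_zero] using this

theorem ngen_comm (i j : ZMod n) (h : coxMatrix n i j = 2) :
    ngen i * ngen j = ngen j * ngen i := by
  have := NilCox.mk_rel (NilCoxRel.comm i j h)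
  simpa only [ngen, map_mul] using this

theorem ngen_braid (i j : ZMod n) (h : coxMatrix n i j = 3) :
    ngen i * ngen j * ngen i = ngen j * ngen i * ngen j := by
  have := NilCox.mk_rel (NilCoxRel.braid i j h)
  simpa only [ngen, map_mul] using this

theorem NilCox.induction {p : NilCox n → Prop} (h_neg_one : p (-1)) (h_gen : ∀ i, p (ngen i))
    (h_add : ∀ x y, p x → p y → p (x + y)) (h_mul : ∀ x y, p x → p y → p (x * y))
    (x : NilCox n) : p x := by
  obtain ⟨x, rfl⟩ := RingQuot.mkRingHom_surjective (NilCoxRel n) x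
  change p (NilCox.mk n x)
  induction x using FreeRing.induction_on with
  | hn1 => rw [map_neg, map_one]; exact h_neg_one
  | hb i => exact h_gen i
  | ha x y hx hy => rw [map_add]; exact h_add _ _ hx hy
  | hm x y hx hy => rw [map_mul]; exact h_mul _ _ hx hy

/-- The universal property of the presentation. -/
noncomputable def NilCox.lift {R : Type*} [Ring R] (f : ZMod n → R)
    (h_nil : ∀ i, f i * f i = 0)
    (h_c : ∀ i j, coxMatrix n i j = 2 → f i * f j = f j * f i)
    (h_b : ∀ i j, coxMatrix n i j = 3 → f i * f j * f i = f j * f i * f j) : NilCox n →+* R :=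
  RingQuot.lift ⟨FreeRing.lift f, by
    intro x y h
    induction h with
    | nil i => simpa using h_nil i
    | comm i j h => simpa using h_c i j h
    | braid i j h => simpa using h_b i j h⟩

theorem NilCox.lift_ngen {R : Type*} [Ring R] (f : ZMod n → R) (h1 h2 h3) (i : ZMod n) :
    NilCox.lift f h1 h2 h3 (ngen i) = f i := by
  refine (RingQuot.lift_mkRingHom_apply _ _ _).trans ?_
  simp

/-- Pairs of an element `x` and an operator `λ ↦ x λ`. -/
abbrev DerPair (n : ℕ) : Type := NilCox n × (Weight n → NilCox n)

/-- Right multiplication by `A_i` on pairs `(x, λ ↦ x λ)`, following the rule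
`x A_i λ = x (r_i λ) A_i + ⟨λ, α_i^∨⟩ x`. -/
noncomputable def pairGen (i : ZMod n) : AddMonoid.End (DerPair n) :=
  AddMonoidHom.mk' (fun p => (p.1 * ngen i, fun l => p.2 (refl i l) * ngen i + coroot i l • p.1)) (by
    intro p q
    refine Prod.ext ?_ ?_
    · simp only [Prod.fst_add, add_mul]
    · funext l
      simp only [Prod.snd_add, Prod.fst_add, Pi.add_apply, add_mul, smul_add]
      abel)

theorem pairGen_apply (i : ZMod n) (p : DerPair n) : pairGen i p =
    (p.1 * ngen i, fun l => p.2 (refl i l) * ngen i + coroot i l • p.1) := rfl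

theorem coroot_refl_self [n.AtLeastTwo] (i : ZMod n) (l : Weight n) :
    coroot i (refl i l) = - coroot i l := by
  rw [refl_apply, map_sub, map_smul, coroot_root_self, smul_eq_mul]; ring

theorem refl_refl [n.AtLeastTwo] (i : ZMod n) (l : Weight n) : refl i (refl i l) = l := by
  rw [refl_apply i (refl i l), coroot_refl_self, refl_apply, neg_smul]; abel

theorem coroot_refl_comm (i j : ZMod n) (h : coxMatrix n i j = 2) (l : Weight n) :
    coroot i (refl j l) = coroot i l := by
  rw [refl_apply, map_sub, map_smul, (cartan_of_two i j h).1, smul_zero, sub_zero]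

theorem refl_comm (i j : ZMod n) (h : coxMatrix n i j = 2) (l : Weight n) :
    refl i (refl j l) = refl j (refl i l) := by
  have h' : coxMatrix n j i = 2 := by rw [(coxMatrix n).symmetric, h]
  rw [refl_apply i, coroot_refl_comm i j h, refl_apply j (refl i l), coroot_refl_comm j i h',
    refl_apply, refl_apply]
  abel

theorem coroot_refl_braid [n.AtLeastTwo] (i j : ZMod n) (h : coxMatrix n i j = 3) (l : Weight n) :
    coroot i (refl j l) = coroot i l + coroot j l := by
  rw [refl_apply, map_sub, map_smul, (cartan_of_three i j h).1, smul_eq_mul]; ring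

theorem refl_braid [n.AtLeastTwo] (i j : ZMod n) (h : coxMatrix n i j = 3) (l : Weight n) :
    refl i (refl j (refl i l)) = refl j (refl i (refl j l)) := by
  have h' : coxMatrix n j i = 3 := by rw [(coxMatrix n).symmetric, h]
  rw [refl_apply i (refl j (refl i l)), coroot_refl_braid i j h, coroot_refl_self,
    coroot_refl_braid j i h', refl_apply j (refl i l), coroot_refl_braid j i h',
    refl_apply j (refl i (refl j l)), coroot_refl_braid j i h', coroot_refl_self,
    coroot_refl_braid i j h, refl_apply i (refl j l), coroot_refl_braid i j h,
    refl_apply, refl_apply]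
  module

/-- The right action of the nilCoxeter algebra on pairs. -/
noncomputable def pairAct (n : ℕ) [n.AtLeastTwo] : NilCox n →+* (AddMonoid.End (DerPair n))ᵐᵒᵖ :=
  NilCox.lift (fun i => MulOpposite.op (pairGen i))
    (fun i => by
      rw [← MulOpposite.op_mul, MulOpposite.op_eq_zero_iff]
      ext p : 1
      change pairGen i (pairGen i p) = 0
      simp only [pairGen_apply, mul_assoc, ngen_sq, add_mul, coroot_refl_self]
      refine Prod.ext (by simp) ?_
      funext l
      simp [mul_assoc])
    (fun i j h => by
      have h' : coxMatrix n j i = 2 := by rw [(coxMatrix n).symmetric, h]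
      rw [← MulOpposite.op_mul, ← MulOpposite.op_mul]
      congr 1
      ext p : 1
      change pairGen j (pairGen i p) = pairGen i (pairGen j p)
      simp only [pairGen_apply, mul_assoc, add_mul, coroot_refl_comm i j h, coroot_refl_comm j i h',
        ngen_comm i j h, refl_comm i j h, smul_mul_assoc]
      refine Prod.ext rfl ?_
      funext l
      simp only
      abel)
    (fun i j h => by
      have h' : coxMatrix n j i = 3 := by rw [(coxMatrix n).symmetric, h]
      simp only [← MulOpposite.op_mul]
      congr 1
      ext p : 1
      change pairGen i (pairGen j (pairGen i p)) = pairGen j (pairGen i (pairGen j p))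
      have hb := ngen_braid i j h
      rw [mul_assoc, mul_assoc] at hb
      simp only [pairGen_apply, mul_assoc, add_mul, coroot_refl_braid i j h,
        coroot_refl_braid j i h', coroot_refl_self, hb, refl_braid i j h, smul_mul_assoc, ngen_sq,
        mul_zero, smul_zero]
      refine Prod.ext rfl ?_
      funext l
      simp only [add_zero]
      module)

theorem pairAct_ngen [n.AtLeastTwo] (i : ZMod n) :
    (pairAct n (ngen i)).unop = pairGen i := by
  rw [pairAct, NilCox.lift_ngen]; rfl

theorem pairAct_mul [n.AtLeastTwo] (x y : NilCox n) (p : DerPair n) :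
    (pairAct n (x * y)).unop p = (pairAct n y).unop ((pairAct n x).unop p) := by
  rw [map_mul]; rfl

theorem pairAct_add [n.AtLeastTwo] (x y : NilCox n) (p : DerPair n) :
    (pairAct n (x + y)).unop p = (pairAct n x).unop p + (pairAct n y).unop p := by
  rw [map_add]; rfl

theorem pairAct_fst [n.AtLeastTwo] (x : NilCox n) (p : DerPair n) :
    ((pairAct n x).unop p).1 = p.1 * x := by
  induction x using NilCox.induction generalizing p with
  | h_neg_one =>
    rw [map_neg, map_one]
    change (-p).1 = _
    simp
  | h_gen i => rw [pairAct_ngen]; rfl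
  | h_add x y hx hy => rw [pairAct_add, Prod.fst_add, hx, hy, mul_add]
  | h_mul x y hx hy => rw [pairAct_mul, hy, hx, mul_assoc]

/-- The right action of a weight on the nilCoxeter algebra. -/
noncomputable def der [n.AtLeastTwo] (l : Weight n) : AddMonoid.End (NilCox n) :=
  AddMonoidHom.mk' (fun x => ((pairAct n x).unop (1, 0)).2 l) (by
    intro x y; rw [pairAct_add]; rfl)

theorem der_one [n.AtLeastTwo] (l : Weight n) : der l (1 : NilCox n) = 0 := by
  change ((pairAct n 1).unop (1, 0)).2 l = 0
  rw [map_one]; rfl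

theorem der_mul_ngen [n.AtLeastTwo] (l : Weight n) (x : NilCox n) (i : ZMod n) :
    der l (x * ngen i) = der (refl i l) x * ngen i + coroot i l • x := by
  change ((pairAct n (x * ngen i)).unop (1, 0)).2 l = _
  rw [pairAct_mul, pairAct_ngen, pairGen_apply]
  simp only [pairAct_fst, one_mul]
  rfl

theorem NilCox.right_induction {p : NilCox n → Prop} (h_one : p 1)
    (h_neg : ∀ x, p x → p (-x))
    (h_add : ∀ x y, p x → p y → p (x + y)) (h_mul : ∀ x i, p x → p (x * ngen i))
    (x : NilCox n) : p x := by
  have key : ∀ y x : NilCox n, p x → p (x * y) := by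
    intro y
    induction y using NilCox.induction with
    | h_neg_one => intro x hx; rw [mul_neg, mul_one]; exact h_neg x hx
    | h_gen i => intro x hx; exact h_mul x i hx
    | h_add y z hy hz => intro x hx; rw [mul_add]; exact h_add _ _ (hy x hx) (hz x hx)
    | h_mul y z hy hz => intro x hx; rw [← mul_assoc]; exact hz _ (hy x hx)
  simpa using key x 1 h_one

theorem der_add [n.AtLeastTwo] (l m : Weight n) : der (l + m) = der l + der (n := n) m := by
  ext x : 1
  change der (l + m) x = der l x + der m x
  induction x using NilCox.right_induction generalizing l m with
  | h_one => simp only [der_one, add_zero]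
  | h_neg x hx => rw [map_neg, map_neg, map_neg, hx]; abel
  | h_add x y hx hy => rw [map_add, map_add, map_add, hx, hy]; abel
  | h_mul x i hx => rw [der_mul_ngen, der_mul_ngen, der_mul_ngen, map_add, hx, map_add, add_mul]; module

theorem der_sub_zsmul [n.AtLeastTwo] (l m : Weight n) (c : ℤ) (x : NilCox n) :
    der (l - c • m) x = der l x - c • der m x := by
  let D : Weight n →+ AddMonoid.End (NilCox n) := AddMonoidHom.mk' der der_add
  change D (l - c • m) x = D l x - c • D m x
  rw [map_sub, map_zsmul]
  rfl

theorem der_comm [n.AtLeastTwo] (l m : Weight n) (x : NilCox n) :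
    der l (der m x) = der m (der l x) := by
  induction x using NilCox.right_induction generalizing l m with
  | h_one => simp only [der_one, map_zero]
  | h_neg x hx => simp only [map_neg, hx]
  | h_add x y hx hy => simp only [map_add, hx, hy]
  | h_mul x i hx =>
    rw [der_mul_ngen, der_mul_ngen, map_add, map_add, der_mul_ngen, der_mul_ngen, map_zsmul,
      map_zsmul, hx (refl i l), refl_apply i l, refl_apply i m, der_sub_zsmul, der_sub_zsmul,
      der_sub_zsmul]
    simp only [map_sub, map_zsmul]
    module

/-- The right action of the nilHecke ring on the nilCoxeter algebra: `A_i` acts by right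
multiplication, and the scalars of degree one annihilate `1`. -/
noncomputable def rightAct (n : ℕ) [n.AtLeastTwo] :
    NilHecke n →+* (AddMonoid.End (NilCox n))ᵐᵒᵖ :=
  NilHecke.lift (fun i => MulOpposite.op (AddMonoidHom.mulRight (ngen i)))
    (fun l => MulOpposite.op (der l))
    (fun l m => by rw [der_add]; rfl)
    (fun l m => by
      rw [← MulOpposite.op_mul, ← MulOpposite.op_mul]
      congr 1
      ext x : 1
      exact der_comm m l x)
    (fun i l => by
      refine MulOpposite.unop_injective ?_
      ext x : 1
      change der l (x * ngen i) = der (refl i l) x * ngen i +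
        (MulOpposite.unop ((coroot i l : ℤ) : (AddMonoid.End (NilCox n))ᵐᵒᵖ)) x
      rw [der_mul_ngen, MulOpposite.unop_intCast, AddMonoid.End.intCast_apply])
    (fun i => by
      refine MulOpposite.unop_injective ?_
      ext x : 1
      change x * ngen i * ngen i = 0
      rw [mul_assoc, ngen_sq, mul_zero])
    (fun i j h => by
      refine MulOpposite.unop_injective ?_
      ext x : 1
      change x * ngen i * ngen j = x * ngen j * ngen i
      rw [mul_assoc, ngen_comm i j h, mul_assoc])
    (fun i j h => by
      refine MulOpposite.unop_injective ?_
      ext x : 1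
      change x * ngen i * ngen j * ngen i = x * ngen j * ngen i * ngen j
      have := congrArg (x * ·) (ngen_braid i j h)
      simpa only [mul_assoc] using this)

theorem rightAct_mul [n.AtLeastTwo] (a b : NilHecke n) (x : NilCox n) :
    (rightAct n (a * b)).unop x = (rightAct n b).unop ((rightAct n a).unop x) := by
  rw [map_mul]; rfl

theorem rightAct_gen [n.AtLeastTwo] (i : ZMod n) (x : NilCox n) :
    (rightAct n (gen i)).unop x = x * ngen i := by
  rw [rightAct, NilHecke.lift_gen]; rfl

/-- The canonical map from the presented nilCoxeter algebra to the nilHecke ring. -/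
noncomputable def nilCoxHom (n : ℕ) : NilCox n →+* NilHecke n :=
  NilCox.lift gen gen_sq gen_comm gen_braid

end

/-- The affine nilCoxeter algebra `A_0`: the subring of `A_aff` generated by the `A_i`. -/
noncomputable def nilCoxeter (n : ℕ) : Subalgebra ℤ (NilHecke n) :=
  Algebra.adjoin ℤ (Set.range (gen (n := n)))

section
variable {n : ℕ}

theorem gen_mem (i : ZMod n) : gen i ∈ nilCoxeter n := Algebra.subset_adjoin ⟨i, rfl⟩

theorem nilCoxHom_mem (x : NilCox n) : nilCoxHom n x ∈ nilCoxeter n := by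
  induction x using NilCox.induction with
  | h_neg_one => rw [map_neg, map_one]; exact neg_mem (one_mem _)
  | h_gen i => rw [nilCoxHom, NilCox.lift_ngen]; exact gen_mem i
  | h_add x y hx hy => rw [map_add]; exact add_mem hx hy
  | h_mul x y hx hy => rw [map_mul]; exact mul_mem hx hy

/-- The specialization map `φ_0 : A_aff → A_0`. It is the additive map that sends `s a` to
`s(0) a` for all `s ∈ S` and `a ∈ A_0`; see `phi_smul_coe`. -/
noncomputable def phi (n : ℕ) [n.AtLeastTwo] : NilHecke n →+ nilCoxeter n :=
  AddMonoidHom.mk' (fun a => ⟨nilCoxHom n ((rightAct n a).unop 1), nilCoxHom_mem _⟩) (by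
    intro a b
    refine Subtype.ext ?_
    change nilCoxHom n ((rightAct n (a + b)).unop 1) = _
    rw [map_add (rightAct n)]
    exact map_add (nilCoxHom n) _ _)

theorem rightAct_scalar_one [n.AtLeastTwo] (s : Scalars n) :
    (rightAct n (scalar n s)).unop 1 = ((evalZero n s : ℤ) : NilCox n) := by
  induction s using SymmetricAlgebra.induction with
  | algebraMap r =>
    rw [AlgHom.commutes, eq_intCast (algebraMap ℤ (Scalars n)), map_intCast, map_intCast,
      MulOpposite.unop_intCast, AddMonoid.End.intCast_apply, zsmul_one]
    rfl
  | ι l =>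
    rw [scalar_ι, evalZero, SymmetricAlgebra.lift_ι_apply, rightAct, NilHecke.lift_wt]
    simpa using der_one l
  | mul a b ha hb =>
    rw [map_mul, rightAct_mul, ha, map_mul, Int.cast_mul, ← zsmul_one, map_zsmul, hb]
    simp
  | add a b ha hb =>
    rw [map_add, map_add (rightAct n), map_add, Int.cast_add, ← ha, ← hb]; rfl

theorem phi_smul [n.AtLeastTwo] (s : Scalars n) (a : NilHecke n) :
    phi n (s • a) = evalZero n s • phi n a := by
  refine Subtype.ext ?_
  change nilCoxHom n ((rightAct n (s • a)).unop 1) =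
    evalZero n s • nilCoxHom n ((rightAct n a).unop 1)
  rw [smul_def, rightAct_mul, rightAct_scalar_one, ← zsmul_one, map_zsmul, map_zsmul]

theorem phi_coe [n.AtLeastTwo] (a : nilCoxeter n) : phi n (a : NilHecke n) = a := by
  have key : ∀ b : NilHecke n, b ∈ nilCoxeter n →
      ∀ x : NilCox n, nilCoxHom n ((rightAct n b).unop x) = nilCoxHom n x * b := by
    intro b hb
    induction hb using Algebra.adjoin_induction with
    | mem b hb =>
      obtain ⟨i, rfl⟩ := hb
      intro x
      rw [rightAct_gen, map_mul, nilCoxHom, NilCox.lift_ngen]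
    | algebraMap r =>
      intro x
      rw [eq_intCast (algebraMap ℤ (NilHecke n)), map_intCast, MulOpposite.unop_intCast,
        AddMonoid.End.intCast_apply, map_zsmul, zsmul_eq_mul, Int.cast_comm]
    | add b c _ _ hb hc =>
      intro x
      rw [mul_add, ← hb, ← hc, ← map_add, map_add (rightAct n)]; rfl
    | mul b c _ _ hb hc =>
      intro x
      rw [rightAct_mul, hc, hb, mul_assoc]
  refine Subtype.ext ?_
  change nilCoxHom n ((rightAct n (a : NilHecke n)).unop 1) = a
  rw [key _ a.2, map_one, one_mul]

theorem phi_smul_coe [n.AtLeastTwo] (s : Scalars n) (a : nilCoxeter n) :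
    phi n (s • (a : NilHecke n)) = evalZero n s • a := by
  rw [phi_smul, phi_coe]

/-- The specialization map `φ_0 : A_aff ⊗_S A_aff → A_0 ⊗_ℤ A_0`, which sends `x ⊗ y` to
`φ_0(x) ⊗ φ_0(y)`, hence `s (a ⊗ b)` to `s(0) (a ⊗ b)` for `s ∈ S` and `a, b ∈ A_0`. -/
noncomputable def phiTensor (n : ℕ) [n.AtLeastTwo] :
    NilHecke n ⊗[Scalars n] NilHecke n →+ nilCoxeter n ⊗[ℤ] nilCoxeter n :=
  TensorProduct.liftAddHom
    (AddMonoidHom.mk' (fun x => AddMonoidHom.mk' (fun y => phi n x ⊗ₜ[ℤ] phi n y)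
      (by intro y z; rw [map_add, TensorProduct.tmul_add]))
      (by
        intro x z; ext y
        simp only [AddMonoidHom.mk'_apply, AddMonoidHom.add_apply, map_add, TensorProduct.add_tmul]))
    (by
      intro s x y
      simp only [AddMonoidHom.mk'_apply, phi_smul]
      rw [TensorProduct.smul_tmul])

theorem phiTensor_tmul [n.AtLeastTwo] (x y : NilHecke n) :
    phiTensor n (x ⊗ₜ[Scalars n] y) = phi n x ⊗ₜ[ℤ] phi n y := rfl

theorem phiTensor_smul_coe [n.AtLeastTwo] (s : Scalars n) (a b : nilCoxeter n) :
    phiTensor n (s • ((a : NilHecke n) ⊗ₜ[Scalars n] (b : NilHecke n))) =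
      evalZero n s • (a ⊗ₜ[ℤ] b) := by
  rw [TensorProduct.smul_tmul', phiTensor_tmul, phi_smul_coe, phi_coe, TensorProduct.smul_tmul']

end

/-! ### The affine Fomin-Stanley subalgebra -/

/-- A word in `ℤ/n` is cyclically decreasing if its letters are distinct and `i + 1` precedes `i`
whenever both occur. -/
def CyclicallyDecreasingWord {n : ℕ} (a : List (ZMod n)) : Prop :=
  a.Nodup ∧ ∀ i, i ∈ a → i + 1 ∈ a → a.idxOf (i + 1) < a.idxOf i

/-- An affine permutation is cyclically decreasing if it is the product of the simple reflections
along some cyclically decreasing word. -/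
def CyclicallyDecreasing {n : ℕ} (w : Waff n) : Prop :=
  ∃ a : List (ZMod n), CyclicallyDecreasingWord a ∧ w = (cs n).wordProd a

theorem cyclicallyDecreasing_finite (n : ℕ) [NeZero n] :
    {w : Waff n | CyclicallyDecreasing w}.Finite := by
  have h : {a : List (ZMod n) | a.Nodup}.Finite := by
    refine (List.finite_length_le (ZMod n) n).subset fun a ha => ?_
    simpa [ZMod.card] using List.Nodup.length_le_card ha
  refine (h.image (cs n).wordProd).subset ?_
  rintro w ⟨a, ha, rfl⟩
  exact ⟨a, ha.1, rfl⟩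

/-- The element `A_w = A_{i_1} ⋯ A_{i_l}`, for a reduced decomposition `w = r_{i_1} ⋯ r_{i_l}`
(any reduced decomposition gives the same element, by the braid relations). -/
noncomputable def A {n : ℕ} (w : Waff n) : NilHecke n :=
  (((cs n).exists_isReduced w).choose.map gen).prod

theorem A_spec {n : ℕ} (w : Waff n) : ∃ a : List (ZMod n),
    (cs n).IsReduced a ∧ w = (cs n).wordProd a ∧ A w = (a.map gen).prod :=
  ⟨_, ((cs n).exists_isReduced w).choose_spec.1, ((cs n).exists_isReduced w).choose_spec.2, rfl⟩

theorem A_mem {n : ℕ} (w : Waff n) : A w ∈ nilCoxeter n := by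
  refine list_prod_mem fun x hx => ?_
  obtain ⟨i, _, rfl⟩ := List.mem_map.1 hx
  exact gen_mem i

/-- `h_i`: the sum of the `A_w` over the cyclically decreasing `w` of length `i`. -/
noncomputable def h (n : ℕ) [NeZero n] (i : ℕ) : NilHecke n :=
  ∑ w ∈ ((cyclicallyDecreasing_finite n).subset
    (Set.sep_subset {w | CyclicallyDecreasing w} fun w => (cs n).length w = i)).toFinset, A w

/-- The affine Fomin-Stanley subalgebra `B`, generated by `h_0, …, h_{n-1}`. -/
noncomputable def fominStanley (n : ℕ) [NeZero n] : Subalgebra ℤ (NilHecke n) :=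
  Algebra.adjoin ℤ {x | ∃ i < n, x = h n i}

theorem fominStanley_le (n : ℕ) [NeZero n] : fominStanley n ≤ nilCoxeter n := by
  refine Algebra.adjoin_le ?_
  rintro x ⟨i, _, rfl⟩
  exact sum_mem fun w _ => A_mem w

/-- The generator `h_i`, `i < n`, as an element of `B`. -/
noncomputable def hB {n : ℕ} [NeZero n] (i : ℕ) (hi : i < n) : fominStanley n :=
  ⟨h n i, Algebra.subset_adjoin ⟨i, hi, rfl⟩⟩

/-- The ring homomorphism `B → B ⊗_ℤ B` is the symmetric function coproduct `Δ_B`, that is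
`Δ_B(h_i) = ∑_{0 ≤ j ≤ i} h_j ⊗ h_{i-j}` for `0 ≤ i ≤ n - 1`. -/
def IsSymmetricCoproduct {n : ℕ} [NeZero n]
    (D : fominStanley n →+* fominStanley n ⊗[ℤ] fominStanley n) : Prop :=
  ∀ (i : ℕ) (hi : i < n), D (hB i hi) =
    ∑ j : Fin (i + 1), hB (j : ℕ) (by omega) ⊗ₜ[ℤ] hB (i - j : ℕ) (by omega)

/-- The map `B ⊗_ℤ B → A_0 ⊗_ℤ A_0` induced by the inclusion of `B` in `A_0`. -/
noncomputable def inclTensor (n : ℕ) [NeZero n] :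
    fominStanley n ⊗[ℤ] fominStanley n →+* nilCoxeter n ⊗[ℤ] nilCoxeter n :=
  (Algebra.TensorProduct.map (Subalgebra.inclusion (fominStanley_le n))
    (Subalgebra.inclusion (fominStanley_le n))).toRingHom

end AffineFS

/-!
Let `ε_c` be the class of the coordinate vector in the weight lattice, and write
`r_i = 1 - α_i A_i` for the simple reflections inside the nilHecke ring `𝔸`.

*Interpolation.* For `c ∈ ℤ/n` the product `T_c = r_{c-1} r_{c-2} ⋯ r_{c+1}` (`transl c`) satisfies
`T_c λ = σ(λ) T_c`, where the rotation `σ : ε_k ↦ ε_{k-1}` does not depend on `c`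
(`transl_mul_wt`), and it is group-like, `Δ(T_c) = T_c ⊗ T_c` (`coprod_transl`). Expanding the
product gives `T_c = ∑_I ∏_{j ∈ I} (ε_c - ε_j) A_I`, where `I` runs over the proper subsets of `ℤ/n`
and `A_I` is the product of the `A_i` along the cyclically decreasing word with letters `I`
(`transl_eq_sum`). So `T_c = H(ε_c)` for one polynomial `H(y) = ∑_{i < n} y^i H_i` with coefficients
in `𝔸` (`transl_eq_interp`), and `H_i` (`hLift n i`) specializes to `h_i` when all `ε_j` are set to
zero (`map_hLift`).

*Consequences.* The points `ε_c` are distinct and `𝔸` and `𝔸 ⊗_S 𝔸` are torsion-free over the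
domain `S`, so identities between polynomials in `y` of degree less than `n` may be checked at the
`ε_c` (`interp_unique`). Therefore `H_i λ = σ(λ) H_i` (`hLift_mul_wt`), and `Δ(H(y))` is
`H(y) ⊗ H(y)` modulo `∏_c (y - ε_c)` (`coprod_hLift`). At zero the modulus becomes `y^n`, and
`φ_0(Δ(h_i)) = ∑_j h_j ⊗ h_{i-j}` (`coprodZero_h`). The commutation rule for `H_i` gives
`φ_0(Δ(h_i b)) = φ_0(Δ(h_i)) φ_0(Δ(b))` (`coprodZero_h_mul`). So `φ_0 ∘ Δ` is a ring homomorphism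
on `B` with values in the image of `B ⊗ B`, and that image is `B ⊗ B` because everything is
torsion-free over `ℤ` (`inclTensor_injective`).

*The nilHecke ring.* That `𝔸` is flat over `S` follows from an action of `𝔸` on the free `S`-module
on words modulo commutation and braid moves, of which `𝔸` is a retract (`fromModule_toModule`).
The same module shows that `A_w` is well defined: the image in `𝔸` of an element of the affine
symmetric group has leading term a nonzero multiple of `A_{i_1} ⋯ A_{i_l}`
(`exists_leading_coeff`, `prod_gen_eq_of_wordProd_eq`). With the description of the cyclically
decreasing elements by their sets of letters this gives `h_i = ∑_{|I| = i} A_I`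
(`h_eq_sum_setProd`).
-/

namespace AffineFS

variable {n : ℕ}

/-! ### The scalars and the divided differences -/

/-- The class of the coordinate vector `ε_c` in the weight lattice. -/
def eps (c : ZMod n) : Weight n := Submodule.Quotient.mk (Pi.single c 1)

theorem root_eq_eps (i : ZMod n) : root i = eps i - eps (i + 1) := rfl

/-- The difference of two coordinates, a well defined functional on the weight lattice. -/
def coordSub (c d : ZMod n) : Weight n →ₗ[ℤ] ℤ :=
  Submodule.liftQ _ ((LinearMap.proj c : (ZMod n → ℤ) →ₗ[ℤ] ℤ) - LinearMap.proj d) (by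
    rw [Submodule.span_le]; simp)

theorem coordSub_mk (c d : ZMod n) (v : ZMod n → ℤ) :
    coordSub c d (Submodule.Quotient.mk v) = v c - v d := rfl

theorem coordSub_eps_sub {c d : ZMod n} (h : c ≠ d) : coordSub c d (eps c - eps d) = 2 := by
  rw [map_sub, eps, eps, coordSub_mk, coordSub_mk]
  simp [h, h.symm]

theorem coroot_eps (i k : ZMod n) :
    coroot i (eps k) = (if i = k then 1 else 0) - (if i + 1 = k then 1 else 0) := by
  simp only [coroot, eps, Submodule.liftQ_apply, LinearMap.sub_apply, LinearMap.proj_apply,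
    Pi.single_apply]

theorem refl_eps_self [n.AtLeastTwo] (i : ZMod n) : refl i (eps i) = eps (i + 1) := by
  rw [refl_apply, coroot_eps, root_eq_eps]
  simp [one_ne_zero' (n := n)]

theorem refl_eps_succ [n.AtLeastTwo] (i : ZMod n) : refl i (eps (i + 1)) = eps i := by
  rw [← refl_eps_self, refl_refl]

theorem refl_eps_of_ne {i k : ZMod n} (h : k ≠ i) (h' : k ≠ i + 1) : refl i (eps k) = eps k := by
  rw [refl_apply, coroot_eps]
  simp [h.symm, h'.symm]

/-- The weight lattice embeds into a free module by the coordinate differences `λ_c - λ_0`. -/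
instance [NeZero n] : Module.Free ℤ (Weight n) := by
  let f : Weight n →ₗ[ℤ] (ZMod n → ℤ) := LinearMap.pi fun c => coordSub c 0
  have hf : Function.Injective f := by
    rw [← LinearMap.ker_eq_bot, eq_bot_iff]
    intro l hl
    induction l using Submodule.Quotient.induction_on with | _ v => ?_
    have h : ∀ c, v c = v 0 := fun c => sub_eq_zero.1 (congrFun (LinearMap.mem_ker.1 hl) c)
    refine (Submodule.Quotient.mk_eq_zero _).2 (Submodule.mem_span_singleton.2 ⟨v 0, ?_⟩)
    funext c
    simp [h c]
  exact Module.Free.of_equiv (LinearEquiv.ofInjective f hf).symm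

theorem ι_ne_zero_of_functional {l : Weight n} (f : Weight n →ₗ[ℤ] ℤ) (h : f l ≠ 0) :
    SymmetricAlgebra.ι ℤ (Weight n) l ≠ 0 := by
  intro h0
  apply h
  have := SymmetricAlgebra.lift_ι_apply f l
  rw [← this, h0, map_zero]

theorem ι_eps_injective :
    Function.Injective fun c : ZMod n => SymmetricAlgebra.ι ℤ (Weight n) (eps c) := by
  intro c d h
  by_contra hcd
  refine ι_ne_zero_of_functional (coordSub c d) (l := eps c - eps d) ?_ ?_
  · rw [coordSub_eps_sub hcd]; norm_num
  · rw [map_sub, sub_eq_zero]; exact h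

theorem ι_root_ne_zero [n.AtLeastTwo] (i : ZMod n) :
    SymmetricAlgebra.ι ℤ (Weight n) (root i) ≠ 0 :=
  ι_ne_zero_of_functional (coroot i) (by rw [coroot_root_self]; norm_num)

theorem ι_ne_zero [NeZero n] {l : Weight n} (h : l ≠ 0) :
    SymmetricAlgebra.ι ℤ (Weight n) l ≠ 0 := by
  let b := Module.Free.chooseBasis ℤ (Weight n)
  obtain ⟨i, hi⟩ : ∃ i, b.coord i l ≠ 0 := by
    by_contra! hc
    exact h (b.forall_coord_eq_zero_iff.1 hc)
  exact ι_ne_zero_of_functional (b.coord i) hi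

/-- The action of the simple reflection `r_i` on the scalars. -/
noncomputable def sRefl (i : ZMod n) : Scalars n →ₐ[ℤ] Scalars n :=
  SymmetricAlgebra.lift ((SymmetricAlgebra.ι ℤ (Weight n)).comp (refl i))

theorem sRefl_ι (i : ZMod n) (l : Weight n) :
    sRefl i (SymmetricAlgebra.ι ℤ (Weight n) l) = SymmetricAlgebra.ι ℤ (Weight n) (refl i l) :=
  SymmetricAlgebra.lift_ι_apply _ _

theorem root_dvd_sub_sRefl (i : ZMod n) (s : Scalars n) :
    SymmetricAlgebra.ι ℤ (Weight n) (root i) ∣ s - sRefl i s := by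
  induction s using SymmetricAlgebra.induction with
  | algebraMap r => rw [AlgHom.commutes, sub_self]; exact dvd_zero _
  | ι l =>
    rw [sRefl_ι, ← map_sub, refl_apply, sub_sub_cancel, map_zsmul, zsmul_eq_mul]
    exact dvd_mul_left _ _
  | mul a b ha hb =>
    rw [map_mul]
    have : a * b - sRefl i a * sRefl i b =
      (a - sRefl i a) * b + sRefl i a * (b - sRefl i b) := by ring
    rw [this]
    exact dvd_add (ha.mul_right _) (hb.mul_left _)
  | add a b ha hb =>
    rw [map_add, add_sub_add_comm]
    exact dvd_add ha hb

/-- The divided difference `∂_i f = (f - r_i f) / α_i` on the scalars. -/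
noncomputable def dem (i : ZMod n) (s : Scalars n) : Scalars n := (root_dvd_sub_sRefl i s).choose

theorem root_mul_dem (i : ZMod n) (s : Scalars n) :
    SymmetricAlgebra.ι ℤ (Weight n) (root i) * dem i s = s - sRefl i s :=
  (root_dvd_sub_sRefl i s).choose_spec.symm

theorem dem_add [n.AtLeastTwo] (i : ZMod n) (s t : Scalars n) :
    dem i (s + t) = dem i s + dem i t := by
  refine mul_left_cancel₀ (ι_root_ne_zero i) ?_
  rw [mul_add, root_mul_dem, root_mul_dem, root_mul_dem, map_add]; ring

theorem dem_mul [n.AtLeastTwo] (i : ZMod n) (s t : Scalars n) :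
    dem i (s * t) = dem i s * t + sRefl i s * dem i t := by
  refine mul_left_cancel₀ (ι_root_ne_zero i) ?_
  rw [mul_add, root_mul_dem, ← mul_assoc, root_mul_dem, mul_left_comm, root_mul_dem, map_mul]; ring

theorem dem_ι [n.AtLeastTwo] (i : ZMod n) (l : Weight n) :
    dem i (SymmetricAlgebra.ι ℤ (Weight n) l) = (coroot i l : ℤ) := by
  refine mul_left_cancel₀ (ι_root_ne_zero i) ?_
  rw [root_mul_dem, sRefl_ι, ← map_sub, refl_apply, sub_sub_cancel, map_zsmul, zsmul_eq_mul,
    mul_comm]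

theorem dem_intCast [n.AtLeastTwo] (i : ZMod n) (r : ℤ) : dem i (r : Scalars n) = 0 := by
  refine mul_left_cancel₀ (ι_root_ne_zero i) ?_
  rw [root_mul_dem, map_intCast, sub_self, mul_zero]

/-! ### A free module for the nilHecke ring -/

/-- The commutation and braid moves on words in `ℤ/n`. -/
inductive BraidMove (n : ℕ) : FreeMonoid (ZMod n) → FreeMonoid (ZMod n) → Prop
  | comm (i j : ZMod n) (h : coxMatrix n i j = 2) : BraidMove n
      (FreeMonoid.of i * FreeMonoid.of j) (FreeMonoid.of j * FreeMonoid.of i)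
  | braid (i j : ZMod n) (h : coxMatrix n i j = 3) : BraidMove n
      (FreeMonoid.of i * FreeMonoid.of j * FreeMonoid.of i)
      (FreeMonoid.of j * FreeMonoid.of i * FreeMonoid.of j)

/-- The monoid of words in `ℤ/n` up to commutation and braid moves. -/
abbrev BraidMonoid (n : ℕ) : Type := (conGen (BraidMove n)).Quotient

namespace BraidMonoid

/-- The class of a one-letter word. -/
def letter (i : ZMod n) : BraidMonoid n := ((FreeMonoid.of i : FreeMonoid (ZMod n)) : BraidMonoid n)

theorem letter_comm (i j : ZMod n) (h : coxMatrix n i j = 2) :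
    letter i * letter j = letter j * letter i :=
  (Con.eq _).2 (ConGen.Rel.of _ _ (BraidMove.comm i j h))

theorem letter_braid (i j : ZMod n) (h : coxMatrix n i j = 3) :
    letter i * letter j * letter i = letter j * letter i * letter j :=
  (Con.eq _).2 (ConGen.Rel.of _ _ (BraidMove.braid i j h))

/-- The universal property of the braid monoid. -/
def lift {M : Type*} [Monoid M] (f : ZMod n → M)
    (h_c : ∀ i j, coxMatrix n i j = 2 → f i * f j = f j * f i)
    (h_b : ∀ i j, coxMatrix n i j = 3 → f i * f j * f i = f j * f i * f j) :
    BraidMonoid n →* M :=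
  Con.lift _ (FreeMonoid.lift f) (Con.conGen_le.2 (by
    intro x y h
    induction h with
    | comm i j h => simpa [Con.ker_rel] using h_c i j h
    | braid i j h => simpa [Con.ker_rel] using h_b i j h))

theorem lift_letter {M : Type*} [Monoid M] (f : ZMod n → M) (h1 h2) (i : ZMod n) :
    lift f h1 h2 (letter i) = f i := by
  refine (Con.lift_coe _ _).trans ?_
  simp

theorem induction {p : BraidMonoid n → Prop} (h_one : p 1)
    (h_letter : ∀ i q, p q → p (letter i * q)) (q : BraidMonoid n) : p q := by
  induction q using Con.induction_on with | _ w => ?_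
  induction w using FreeMonoid.inductionOn' with
  | one => exact h_one
  | of_mul i w hw => exact h_letter i _ hw

/-- The length of a word, which the moves preserve. -/
def len (n : ℕ) : BraidMonoid n →* Multiplicative ℕ :=
  lift (fun _ => Multiplicative.ofAdd 1) (fun _ _ _ => rfl) (fun _ _ _ => rfl)

/-- A class of words is dead if one of its words has two equal adjacent letters. -/
def Dead (q : BraidMonoid n) : Prop := ∃ a b i, q = a * (letter i * letter i) * b

theorem Dead.mul_left {q : BraidMonoid n} (h : Dead q) (p : BraidMonoid n) : Dead (p * q) := by
  obtain ⟨a, b, i, rfl⟩ := h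
  exact ⟨p * a, b, i, by simp only [mul_assoc]⟩

theorem dead_letter_letter (i : ZMod n) (q : BraidMonoid n) : Dead (letter i * (letter i * q)) :=
  ⟨1, q, i, by rw [one_mul, mul_assoc]⟩

theorem not_dead_one : ¬ Dead (1 : BraidMonoid n) := by
  rintro ⟨a, b, i, h⟩
  have := congrArg (fun q => (len n q).toAdd) h
  simp only [map_one, map_mul, toAdd_mul, len, lift_letter, toAdd_ofAdd, toAdd_one] at this
  omega

end BraidMonoid

open BraidMonoid

/-- The free module of scalar combinations of braid classes. The nilHecke ring acts on it, where
`A_i` sends a class `q` to `i q`, or to zero if `i q` is dead. -/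
abbrev BraidModule (n : ℕ) : Type := BraidMonoid n →₀ Scalars n

open Classical in
/-- The vector `s q` of the braid module, which is zero if the class `q` is dead. -/
noncomputable def liveSingle (q : BraidMonoid n) : Scalars n →+ BraidModule n :=
  if Dead q then 0 else Finsupp.singleAddHom q

theorem liveSingle_of_dead {q : BraidMonoid n} (h : Dead q) : liveSingle q = 0 := if_pos h

theorem liveSingle_of_not_dead {q : BraidMonoid n} (h : ¬ Dead q) (s : Scalars n) :
    liveSingle q s = Finsupp.single q s := by
  rw [liveSingle, if_neg h]; rfl

theorem smul_liveSingle (q : BraidMonoid n) (s t : Scalars n) :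
    s • liveSingle q t = liveSingle q (s * t) := by
  by_cases h : Dead q
  · rw [liveSingle_of_dead h]; exact smul_zero _
  · rw [liveSingle_of_not_dead h, liveSingle_of_not_dead h, Finsupp.smul_single, smul_eq_mul]

/-- An additive map on the braid module that is semilinear with respect to some map of weights and
vanishes on the basis is zero. -/
theorem eq_zero_of_semilinear {D : AddMonoid.End (BraidModule n)} (σ : Weight n → Weight n)
    (hD : ∀ l m, D (SymmetricAlgebra.ι ℤ (Weight n) l • m) =
      SymmetricAlgebra.ι ℤ (Weight n) (σ l) • D m)
    (h1 : ∀ q, D (Finsupp.single q 1) = 0) : D = 0 := by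
  have key : ∀ (s : Scalars n) (m : BraidModule n), D m = 0 → D (s • m) = 0 := by
    intro s
    induction s using SymmetricAlgebra.induction with
    | algebraMap r =>
      intro m hm
      rw [algebraMap_smul, map_zsmul, hm, smul_zero]
    | ι l => intro m hm; rw [hD, hm, smul_zero]
    | mul a b ha hb => intro m hm; rw [mul_smul]; exact ha _ (hb _ hm)
    | add a b ha hb => intro m hm; rw [add_smul, map_add, ha _ hm, hb _ hm, add_zero]
  ext m : 1
  change D m = 0
  induction m using Finsupp.induction_linear with
  | zero => exact map_zero _
  | add m m' h h' => rw [map_add, h, h', add_zero]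
  | single q t =>
    have := key t _ (h1 q)
    rwa [Finsupp.smul_single, smul_eq_mul, mul_one] at this

section
variable [n.AtLeastTwo]

/-- The divided difference as an additive map. -/
noncomputable def demHom (i : ZMod n) : Scalars n →+ Scalars n :=
  AddMonoidHom.mk' (dem i) (dem_add i)

/-- The action of `A_i` on the braid module, `A_i (s q) = (r_i s) (i q) + (∂_i s) q`. -/
noncomputable def genMod (i : ZMod n) : AddMonoid.End (BraidModule n) :=
  Finsupp.liftAddHom fun q =>
    (liveSingle (letter i * q)).comp (sRefl i : Scalars n →+* Scalars n).toAddMonoidHom +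
      (Finsupp.singleAddHom q).comp (demHom i)

theorem genMod_single (i : ZMod n) (q : BraidMonoid n) (s : Scalars n) :
    genMod i (Finsupp.single q s) =
      liveSingle (letter i * q) (sRefl i s) + Finsupp.single q (dem i s) := by
  exact Finsupp.liftAddHom_apply_single _ _ _

theorem genMod_single_one (i : ZMod n) (q : BraidMonoid n) :
    genMod i (Finsupp.single q 1) = liveSingle (letter i * q) 1 := by
  have := dem_intCast (n := n) i 1
  rw [Int.cast_one] at this
  rw [genMod_single, map_one, this, Finsupp.single_zero, add_zero]

theorem genMod_liveSingle_one (i : ZMod n) (q : BraidMonoid n) :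
    genMod i (liveSingle q 1) = liveSingle (letter i * q) 1 := by
  by_cases h : Dead q
  · rw [liveSingle_of_dead h, liveSingle_of_dead (h.mul_left _)]
    exact map_zero _
  · rw [liveSingle_of_not_dead h, genMod_single_one]

theorem genMod_smul (i : ZMod n) (s : Scalars n) (m : BraidModule n) :
    genMod i (s • m) = sRefl i s • genMod i m + dem i s • m := by
  induction m using Finsupp.induction_linear with
  | zero => simp
  | add m m' h h' => rw [smul_add, map_add, h, h', map_add]; module
  | single q t =>
    rw [Finsupp.smul_single, smul_eq_mul, genMod_single, genMod_single, map_mul, dem_mul,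
      smul_add, smul_liveSingle, Finsupp.single_add, Finsupp.smul_single, Finsupp.smul_single,
      smul_eq_mul, smul_eq_mul]
    abel

theorem genMod_ι_smul (i : ZMod n) (l : Weight n) (m : BraidModule n) :
    genMod i (SymmetricAlgebra.ι ℤ (Weight n) l • m) =
      SymmetricAlgebra.ι ℤ (Weight n) (refl i l) • genMod i m + coroot i l • m := by
  rw [genMod_smul, sRefl_ι, dem_ι, Int.cast_smul_eq_zsmul]

theorem genMod_genMod (i : ZMod n) : genMod i * genMod i = 0 := by
  refine eq_zero_of_semilinear id (fun l m => ?_) (fun q => ?_)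
  · change genMod i (genMod i _) = _ • genMod i (genMod i m)
    rw [genMod_ι_smul, map_add, genMod_ι_smul, map_zsmul, coroot_refl_self, refl_refl]
    simp
  · change genMod i (genMod i _) = 0
    rw [genMod_single_one, genMod_liveSingle_one, liveSingle_of_dead (dead_letter_letter i q)]
    rfl

/-- The action of the nilHecke ring on the braid module. On the nil, commutation and braid
relations, the difference of the two sides is semilinear over the scalars, so that it is enough to
check them on the basis. -/
noncomputable def modAct (n : ℕ) [n.AtLeastTwo] : NilHecke n →+* AddMonoid.End (BraidModule n) :=
  NilHecke.lift genMod
    (fun l => Module.toAddMonoidEnd (Scalars n) _ (SymmetricAlgebra.ι ℤ (Weight n) l))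
    (fun l m => by rw [map_add, map_add])
    (fun l m => by rw [← map_mul, mul_comm, map_mul])
    (fun i l => by
      ext m : 1
      change _ = SymmetricAlgebra.ι ℤ (Weight n) (refl i l) • genMod i m +
        ((coroot i l : ℤ) : AddMonoid.End (BraidModule n)) m
      rw [AddMonoid.End.intCast_apply]
      exact genMod_ι_smul i l m)
    genMod_genMod
    (fun i j h => by
      have h' : coxMatrix n j i = 2 := by rw [(coxMatrix n).symmetric, h]
      refine sub_eq_zero.1 (eq_zero_of_semilinear (fun l => refl i (refl j l)) (fun l m => ?_)
        (fun q => ?_))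
      · change genMod i (genMod j _) - genMod j (genMod i _) =
          _ • (genMod i (genMod j m) - genMod j (genMod i m))
        simp only [genMod_ι_smul, map_add, map_zsmul, coroot_refl_comm i j h,
          coroot_refl_comm j i h', refl_comm i j h, smul_sub]
        abel
      · change genMod i (genMod j _) - genMod j (genMod i _) = 0
        rw [genMod_single_one, genMod_liveSingle_one, genMod_single_one, genMod_liveSingle_one,
          ← mul_assoc, letter_comm i j h, mul_assoc, sub_self])
    (fun i j h => by
      have h' : coxMatrix n j i = 3 := by rw [(coxMatrix n).symmetric, h]
      have hn : ∀ k (m : BraidModule n), genMod k (genMod k m) = 0 := fun k m =>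
        DFunLike.congr_fun (genMod_genMod k) m
      refine sub_eq_zero.1 (eq_zero_of_semilinear (fun l => refl i (refl j (refl i l)))
        (fun l m => ?_) (fun q => ?_))
      · change genMod i (genMod j (genMod i _)) - genMod j (genMod i (genMod j _)) =
          _ • (genMod i (genMod j (genMod i m)) - genMod j (genMod i (genMod j m)))
        simp only [genMod_ι_smul, map_add, map_zsmul, coroot_refl_braid i j h,
          coroot_refl_braid j i h', coroot_refl_self, refl_braid i j h, smul_sub, hn]
        module
      · change genMod i (genMod j (genMod i _)) - genMod j (genMod i (genMod j _)) = 0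
        simp only [genMod_single_one, genMod_liveSingle_one]
        rw [← mul_assoc, ← mul_assoc, letter_braid i j h, ← mul_assoc, ← mul_assoc, sub_self])

theorem modAct_gen (i : ZMod n) : modAct n (gen i) = genMod i := by
  rw [modAct, NilHecke.lift_gen]

theorem modAct_mul (a b : NilHecke n) (m : BraidModule n) :
    modAct n (a * b) m = modAct n a (modAct n b m) := by
  rw [map_mul]; rfl

theorem modAct_scalar (s : Scalars n) (m : BraidModule n) :
    modAct n (scalar n s) m = s • m := by
  induction s using SymmetricAlgebra.induction generalizing m with
  | algebraMap r =>
    rw [eq_intCast (algebraMap ℤ (Scalars n)), map_intCast, map_intCast,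
      AddMonoid.End.intCast_apply, Int.cast_smul_eq_zsmul]
  | ι l => rw [scalar_ι, modAct, NilHecke.lift_wt]; rfl
  | mul a b ha hb => rw [map_mul, modAct_mul, mul_smul, hb, ha]
  | add a b ha hb => rw [map_add, map_add, add_smul, ← hb, ← ha]; rfl

end

theorem NilHecke.induction {p : NilHecke n → Prop} (h_neg_one : p (-1)) (h_gen : ∀ i, p (gen i))
    (h_wt : ∀ l, p (wt l)) (h_add : ∀ x y, p x → p y → p (x + y))
    (h_mul : ∀ x y, p x → p y → p (x * y)) (x : NilHecke n) : p x := by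
  obtain ⟨x, rfl⟩ := NilHecke.mk_surjective n x
  induction x using FreeRing.induction_on with
  | hn1 => rw [map_neg, map_one]; exact h_neg_one
  | hb i =>
    cases i with
    | inl i => exact h_gen i
    | inr l => exact h_wt l
  | ha x y hx hy => rw [map_add]; exact h_add _ _ hx hy
  | hm x y hx hy => rw [map_mul]; exact h_mul _ _ hx hy

/-- The commutation rule of `A_i` with all scalars. -/
theorem gen_mul_scalar [n.AtLeastTwo] (i : ZMod n) (s : Scalars n) :
    gen i * scalar n s = scalar n (sRefl i s) * gen i + scalar n (dem i s) := by
  induction s using SymmetricAlgebra.induction with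
  | algebraMap r =>
    rw [eq_intCast (algebraMap ℤ (Scalars n)), dem_intCast, map_intCast, map_intCast, map_intCast,
      map_zero, add_zero, Int.cast_comm]
  | ι l => rw [sRefl_ι, dem_ι, scalar_ι, scalar_ι, map_intCast, gen_wt]
  | mul a b ha hb =>
    rw [map_mul, ← mul_assoc, ha, add_mul, mul_assoc, hb, dem_mul, map_mul, map_mul, map_add,
      map_mul, map_mul]
    noncomm_ring
  | add a b ha hb => rw [map_add, mul_add, ha, hb, map_add, map_add, dem_add, map_add]; noncomm_ring

/-- The product of the `A_i` along the words of a braid class. -/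
noncomputable def braidProd (n : ℕ) : BraidMonoid n →* NilHecke n :=
  BraidMonoid.lift gen gen_comm gen_braid

theorem braidProd_of_dead {q : BraidMonoid n} (h : Dead q) : braidProd n q = 0 := by
  obtain ⟨a, b, i, rfl⟩ := h
  simp only [map_mul, braidProd, lift_letter, gen_sq, mul_zero, zero_mul]

/-- The linear map from the braid module to the nilHecke ring which sends a braid class to its
product. -/
noncomputable def fromModule (n : ℕ) : BraidModule n →ₗ[Scalars n] NilHecke n :=
  Finsupp.linearCombination (Scalars n) (braidProd n)

theorem fromModule_liveSingle (q : BraidMonoid n) (s : Scalars n) :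
    fromModule n (liveSingle q s) = s • braidProd n q := by
  by_cases h : Dead q
  · rw [liveSingle_of_dead h, braidProd_of_dead h, smul_zero]; exact map_zero _
  · rw [liveSingle_of_not_dead h, fromModule, Finsupp.linearCombination_single]

section
variable [n.AtLeastTwo]

/-- The map from the braid module is linear over the nilHecke ring. -/
theorem fromModule_modAct (a : NilHecke n) (m : BraidModule n) :
    fromModule n (modAct n a m) = a * fromModule n m := by
  induction a using NilHecke.induction generalizing m with
  | h_neg_one =>
    rw [map_neg, map_one, neg_one_mul, ← map_neg]; rfl
  | h_gen i =>
    rw [modAct_gen]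
    induction m using Finsupp.induction_linear with
    | zero => simp
    | add m m' h h' => rw [map_add, map_add, h, h', map_add, mul_add]
    | single q s =>
      rw [genMod_single, map_add, fromModule_liveSingle, fromModule,
        Finsupp.linearCombination_single, Finsupp.linearCombination_single, smul_def, smul_def,
        smul_def, ← mul_assoc, gen_mul_scalar, map_mul, braidProd, lift_letter, add_mul, mul_assoc]
  | h_wt l => rw [← scalar_ι, modAct_scalar, map_smul, smul_def]
  | h_add x y hx hy => rw [map_add, add_mul, ← hx, ← hy, ← map_add (fromModule n)]; rfl
  | h_mul x y hx hy => rw [modAct_mul, hx, hy, mul_assoc]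

/-- The action on the basis vector of the empty word, a linear map from the nilHecke ring to the
braid module. -/
noncomputable def toModule (n : ℕ) [n.AtLeastTwo] : NilHecke n →ₗ[Scalars n] BraidModule n where
  toFun a := modAct n a (Finsupp.single 1 1)
  map_add' a b := by rw [map_add]; rfl
  map_smul' s a := by rw [smul_def, modAct_mul, modAct_scalar]; rfl

/-- Both maps are linear over the nilHecke ring and `1 ↦ [∅] ↦ 1`. -/
theorem fromModule_toModule (a : NilHecke n) : fromModule n (toModule n a) = a := by
  refine (fromModule_modAct a _).trans ?_
  rw [fromModule, Finsupp.linearCombination_single, map_one, one_smul, mul_one]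

theorem toModule_braidProd (q : BraidMonoid n) :
    toModule n (braidProd n q) = liveSingle q 1 := by
  induction q using BraidMonoid.induction with
  | h_one =>
    rw [map_one, liveSingle_of_not_dead not_dead_one]
    change modAct n 1 _ = _
    rw [map_one]; rfl
  | h_letter i q hq =>
    rw [map_mul, ← genMod_liveSingle_one, ← hq, braidProd, lift_letter]
    change modAct n (gen i * _) _ = _
    rw [modAct_mul, modAct_gen]; rfl

/-- The nilHecke ring is flat over the scalars, as a retract of a free module. -/
instance : Module.Flat (Scalars n) (NilHecke n) :=
  Module.Flat.of_retract (toModule n) (fromModule n) (LinearMap.ext fromModule_toModule)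

end

/-! ### Leading terms and reduced words -/

section
variable [n.AtLeastTwo]

theorem simpleRefl_mul_self (i : ZMod n) : simpleRefl i * simpleRefl i = 1 := by
  have h : gen i * (wt (root i) * gen i) = 2 * gen i := by
    rw [← mul_assoc, gen_root_self, add_mul, neg_mul, mul_assoc, gen_sq, mul_zero, neg_zero,
      zero_add]
  rw [simpleRefl, sub_mul, mul_sub, mul_assoc, mul_sub, h, two_mul]
  noncomm_ring

theorem simpleRefl_comm (i j : ZMod n) (h : coxMatrix n i j = 2) :
    simpleRefl i * simpleRefl j = simpleRefl j * simpleRefl i := by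
  have h' : coxMatrix n j i = 2 := by rw [(coxMatrix n).symmetric, h]
  have e : simpleRefl i * gen j = gen j * simpleRefl i := by
    rw [simpleRefl, mul_sub, sub_mul, ← mul_assoc, gen_root_comm j i h', mul_assoc, mul_assoc,
      gen_comm i j h, mul_one, one_mul]
  have e' : simpleRefl i * wt (root j) = wt (root j) * simpleRefl i := by
    rw [simpleRefl_wt, refl_root, (cartan_of_two i j h).1, zero_smul, sub_zero]
  rw [simpleRefl.eq_def j, mul_sub, sub_mul, ← mul_assoc, e', mul_assoc, e, mul_one, one_mul,
    mul_assoc]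

theorem simpleRefl_braid (i j : ZMod n) (h : coxMatrix n i j = 3) :
    simpleRefl i * simpleRefl j * simpleRefl i = simpleRefl j * simpleRefl i * simpleRefl j := by
  have h' : coxMatrix n j i = 3 := by rw [(coxMatrix n).symmetric, h]
  exact (braid_aux (gen i) (gen j) (wt (root i)) (wt (root j)) (wt_comm _ _)
    (gen_sq i) (gen_sq j) (gen_braid j i h') (gen_root_self i) (gen_root_self j)
    (gen_root_braid i j h) (gen_root_braid j i h')).2.2

/-- The elements `1 - α_i A_i` satisfy the relations of the affine symmetric group. -/
theorem isLiftable_simpleRefl :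
    (coxMatrix n).IsLiftable (simpleRefl : ZMod n → NilHecke n) := by
  have hM : ∀ i j : ZMod n, coxMatrix n i j = 0 ∨ i = j ∨ coxMatrix n i j = 2 ∨
      coxMatrix n i j = 3 := by
    intro i j
    change (if i = j then 1 else if n = 2 then 0 else if j = i + 1 ∨ i = j + 1 then 3 else 2) = 0 ∨
      i = j ∨ (if i = j then 1 else if n = 2 then 0 else if j = i + 1 ∨ i = j + 1 then 3 else 2) = 2
      ∨ (if i = j then 1 else if n = 2 then 0 else if j = i + 1 ∨ i = j + 1 then 3 else 2) = 3
    split_ifs <;> simp_all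
  intro i j
  rcases hM i j with h | rfl | h | h
  · rw [h, pow_zero]
  · rw [(coxMatrix n).diagonal, pow_one, simpleRefl_mul_self]
  · rw [h, pow_two]
    nth_rewrite 2 [simpleRefl_comm i j h]
    rw [mul_assoc, ← mul_assoc (simpleRefl j), simpleRefl_mul_self, one_mul, simpleRefl_mul_self]
  · rw [h, pow_succ, pow_two]
    have e := simpleRefl_braid i j h
    calc simpleRefl i * simpleRefl j * (simpleRefl i * simpleRefl j) *
          (simpleRefl i * simpleRefl j)
        = (simpleRefl i * simpleRefl j * simpleRefl i) *
          (simpleRefl j * simpleRefl i * simpleRefl j) := by noncomm_ring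
      _ = simpleRefl i * simpleRefl j * (simpleRefl i * simpleRefl i) * simpleRefl j *
          simpleRefl i := by rw [← e]; noncomm_ring
      _ = 1 := by
        rw [simpleRefl_mul_self, mul_one, mul_assoc (simpleRefl i), simpleRefl_mul_self, mul_one,
          simpleRefl_mul_self]

/-- The affine symmetric group inside the nilHecke ring. -/
noncomputable def weylHom (n : ℕ) [n.AtLeastTwo] : Waff n →* NilHecke n :=
  (cs n).lift ⟨simpleRefl, isLiftable_simpleRefl⟩

theorem weylHom_wordProd (a : List (ZMod n)) :
    weylHom n ((cs n).wordProd a) = (a.map simpleRefl).prod := by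
  rw [CoxeterSystem.wordProd, map_list_prod, List.map_map]
  congr 2
  funext i
  exact (cs n).lift_apply_simple isLiftable_simpleRefl i

end

/-- The composite of the simple reflections of weights along a word. -/
def reflWord (a : List (ZMod n)) : Module.End ℤ (Weight n) := (a.map refl).prod

theorem reflWord_cons (i : ZMod n) (a : List (ZMod n)) (l : Weight n) :
    reflWord (i :: a) l = refl i (reflWord a l) := by
  rw [reflWord, List.map_cons, List.prod_cons]; rfl

theorem reflWord_append (a b : List (ZMod n)) (l : Weight n) :
    reflWord (a ++ b) l = reflWord a (reflWord b l) := by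
  rw [reflWord, List.map_append, List.prod_append]; rfl

theorem reflWord_ne_zero [n.AtLeastTwo] (a : List (ZMod n)) {l : Weight n} (h : l ≠ 0) :
    reflWord a l ≠ 0 := by
  induction a with
  | nil => exact h
  | cons i a ih =>
    intro h0
    apply ih
    have := congrArg (refl i) h0
    rwa [map_zero, reflWord_cons, refl_refl] at this

theorem simpleRefl_prod_wt [n.AtLeastTwo] (a : List (ZMod n)) (l : Weight n) :
    (a.map simpleRefl).prod * wt l = wt (reflWord a l) * (a.map simpleRefl).prod := by
  induction a with
  | nil => simp [reflWord]
  | cons i a ih =>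
    rw [List.map_cons, List.prod_cons, mul_assoc, ih, ← mul_assoc, simpleRefl_wt, mul_assoc,
      reflWord_cons]

theorem root_ne_zero [n.AtLeastTwo] (i : ZMod n) : root i ≠ 0 := by
  intro h
  have := coroot_root_self i
  rw [h, map_zero] at this
  norm_num at this

/-- The class of a word in the braid monoid. -/
def wordClass (a : List (ZMod n)) : BraidMonoid n := (a.map letter).prod

theorem braidProd_wordClass (a : List (ZMod n)) :
    braidProd n (wordClass a) = (a.map gen).prod := by
  rw [wordClass, map_list_prod, List.map_map]
  congr 2

theorem len_wordClass (a : List (ZMod n)) : (len n (wordClass a)).toAdd = a.length := by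
  induction a with
  | nil => simp [wordClass]
  | cons i a ih =>
    rw [wordClass, List.map_cons, List.prod_cons, map_mul, toAdd_mul, List.length_cons]
    rw [wordClass] at ih
    rw [ih, len, lift_letter, toAdd_ofAdd, add_comm]

/-- The scalar combinations of products of fewer than `k` generators `A_i`. -/
noncomputable def shorter (n k : ℕ) : Submodule (Scalars n) (NilHecke n) :=
  Submodule.span (Scalars n) (braidProd n '' {q | (len n q).toAdd < k})

theorem shorter_mono {k l : ℕ} (h : k ≤ l) : shorter n k ≤ shorter n l :=
  Submodule.span_mono (Set.image_mono fun _ hq => lt_of_lt_of_le hq h)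

theorem prod_gen_mem_shorter {a : List (ZMod n)} {k : ℕ} (h : a.length < k) :
    (a.map gen).prod ∈ shorter n k := by
  rw [← braidProd_wordClass]
  exact Submodule.subset_span ⟨_, by rwa [Set.mem_ofPred_eq, len_wordClass], rfl⟩

theorem mul_gen_mem_shorter {k : ℕ} {x : NilHecke n} (hx : x ∈ shorter n k) (i : ZMod n) :
    x * gen i ∈ shorter n (k + 1) := by
  induction hx using Submodule.span_induction with
  | mem x hx =>
    obtain ⟨q, hq, rfl⟩ := hx
    refine Submodule.subset_span ⟨q * letter i, ?_, ?_⟩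
    · have : (len n q).toAdd < k := hq
      rw [Set.mem_ofPred_eq, map_mul, toAdd_mul, len, lift_letter, toAdd_ofAdd]
      exact Nat.succ_lt_succ this
    · rw [map_mul]
      congr 1
  | zero => rw [zero_mul]; exact zero_mem _
  | add x y _ _ hx hy => rw [add_mul]; exact add_mem hx hy
  | smul s x _ hx =>
    rw [smul_def, mul_assoc, ← smul_def]
    exact Submodule.smul_mem _ _ hx

/-- The coefficients of an element of `shorter n k` at classes of length at least `k` vanish. -/
theorem toModule_apply_of_mem_shorter [n.AtLeastTwo] {k : ℕ} {x : NilHecke n}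
    (hx : x ∈ shorter n k) {q : BraidMonoid n} (hq : k ≤ (len n q).toAdd) :
    toModule n x q = 0 := by
  induction hx using Submodule.span_induction with
  | mem x hx =>
    obtain ⟨p, hp, rfl⟩ := hx
    rw [toModule_braidProd]
    by_cases hd : Dead p
    · rw [liveSingle_of_dead hd]; rfl
    · rw [liveSingle_of_not_dead hd, Finsupp.single_eq_of_ne]
      rintro rfl
      exact absurd hp (not_lt.2 hq)
  | zero => rw [map_zero]; rfl
  | add x y _ _ hx hy => rw [map_add, Finsupp.add_apply, hx, hy, add_zero]
  | smul s x _ hx => rw [map_smul, Finsupp.smul_apply, hx, smul_zero]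

section
variable [n.AtLeastTwo]

/-- The leading term of a product of reflections `1 - α_i A_i` along a word is a nonzero multiple
(a product of roots, up to sign) of the product of the `A_i`. -/
theorem exists_leading_coeff (a : List (ZMod n)) : ∃ c : Scalars n, c ≠ 0 ∧
    (a.map simpleRefl).prod - c • (a.map gen).prod ∈ shorter n a.length := by
  induction a using List.reverseRecOn with
  | nil => exact ⟨1, one_ne_zero, by simp⟩
  | append_singleton a i ih =>
    obtain ⟨c, hc, h⟩ := ih
    refine ⟨-(SymmetricAlgebra.ι ℤ (Weight n) (reflWord a (root i)) * c),
      neg_ne_zero.2 (mul_ne_zero (ι_ne_zero (reflWord_ne_zero a (root_ne_zero i))) hc), ?_⟩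
    -- `r_a r_i = r_a - w(α_i) r_a A_i`, where `w` is the composite of the reflections of weights
    -- along `a`; the new leading coefficient is `-w(α_i)` times the old one
    have e : ((a ++ [i]).map simpleRefl).prod -
        -(SymmetricAlgebra.ι ℤ (Weight n) (reflWord a (root i)) * c) • ((a ++ [i]).map gen).prod =
        ((a.map simpleRefl).prod - c • (a.map gen).prod) + c • (a.map gen).prod -
        SymmetricAlgebra.ι ℤ (Weight n) (reflWord a (root i)) •
          (((a.map simpleRefl).prod - c • (a.map gen).prod) * gen i) := by
      simp only [List.map_append, List.map_cons, List.map_nil, List.prod_append, List.prod_cons,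
        List.prod_nil, mul_one, simpleRefl.eq_def i]
      rw [mul_sub, mul_one, ← mul_assoc, simpleRefl_prod_wt, neg_smul, mul_smul, sub_mul, smul_sub,
        ι_smul, ι_smul, smul_def, smul_def, ι_smul]
      noncomm_ring
    rw [e, List.length_append, List.length_singleton]
    refine sub_mem (add_mem (shorter_mono (Nat.le_succ _) h) (Submodule.smul_mem _ _ ?_))
      (Submodule.smul_mem _ _ (mul_gen_mem_shorter h i))
    exact prod_gen_mem_shorter (Nat.lt_succ_self _)

/-- The product of the `A_i` along a word that is not dead has nonzero coefficient at the class of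
the word. -/
theorem dead_of_coeff {a : List (ZMod n)} {c : Scalars n} (hc : c ≠ 0)
    (h : toModule n (c • (a.map gen).prod) (wordClass a) = 0) : Dead (wordClass a) := by
  by_contra hd
  rw [map_smul, ← braidProd_wordClass, toModule_braidProd, liveSingle_of_not_dead hd,
    Finsupp.smul_apply, Finsupp.single_eq_same, smul_eq_mul, mul_one] at h
  exact hc h

theorem toModule_apply_of_ne {a : List (ZMod n)} {q : BraidMonoid n} (h : wordClass a ≠ q) :
    toModule n (a.map gen).prod q = 0 := by
  rw [← braidProd_wordClass, toModule_braidProd]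
  by_cases hd : Dead (wordClass a)
  · rw [liveSingle_of_dead hd]; rfl
  · rw [liveSingle_of_not_dead hd, Finsupp.single_eq_of_ne h.symm]

/-- The product of the `A_i` along a word that is not reduced vanishes. -/
theorem prod_gen_eq_zero_of_shorter {a b : List (ZMod n)}
    (h : (cs n).wordProd a = (cs n).wordProd b) (hl : b.length < a.length) :
    (a.map gen).prod = 0 := by
  obtain ⟨c, hc, ha⟩ := exists_leading_coeff a
  obtain ⟨d, hd, hb⟩ := exists_leading_coeff b
  have hab := congrArg (weylHom n) h
  rw [weylHom_wordProd, weylHom_wordProd] at hab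
  have hb' : (a.map simpleRefl).prod ∈ shorter n a.length := by
    rw [hab, ← sub_add_cancel (b.map simpleRefl).prod (d • (b.map gen).prod)]
    exact add_mem (shorter_mono hl.le hb) (Submodule.smul_mem _ _ (prod_gen_mem_shorter hl))
  have hm : c • (a.map gen).prod ∈ shorter n a.length := by
    simpa using sub_mem hb' ha
  rw [← braidProd_wordClass]
  exact braidProd_of_dead (dead_of_coeff hc (toModule_apply_of_mem_shorter hm (len_wordClass a).ge))

/-- Two words of the same length with the same product in the affine symmetric group have the same
product of the `A_i`: the two expansions of this group element in the nilHecke ring have the same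
leading term. -/
theorem prod_gen_eq_of_wordProd_eq {a b : List (ZMod n)}
    (h : (cs n).wordProd a = (cs n).wordProd b) (hl : a.length = b.length) :
    (a.map gen).prod = (b.map gen).prod := by
  obtain ⟨c, hc, ha⟩ := exists_leading_coeff a
  obtain ⟨d, hd, hb⟩ := exists_leading_coeff b
  have hab := congrArg (weylHom n) h
  rw [weylHom_wordProd, weylHom_wordProd] at hab
  rw [← hl] at hb
  have hm : c • (a.map gen).prod - d • (b.map gen).prod ∈ shorter n a.length := by
    have := sub_mem hb ha
    rwa [hab, sub_sub_sub_cancel_left] at this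
  by_cases hq : wordClass a = wordClass b
  · rw [← braidProd_wordClass, hq, braidProd_wordClass]
  · have h1 := toModule_apply_of_mem_shorter hm (len_wordClass a).ge
    have h2 := toModule_apply_of_mem_shorter hm (hl.trans_le (len_wordClass b).ge)
    rw [map_sub, Finsupp.sub_apply, map_smul (toModule n) d, Finsupp.smul_apply d,
      toModule_apply_of_ne (Ne.symm hq), smul_zero, sub_zero] at h1
    rw [map_sub, Finsupp.sub_apply, map_smul (toModule n) c, Finsupp.smul_apply c,
      toModule_apply_of_ne hq, smul_zero, zero_sub, neg_eq_zero] at h2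
    rw [← braidProd_wordClass, braidProd_of_dead (dead_of_coeff hc h1), ← braidProd_wordClass,
      braidProd_of_dead (dead_of_coeff hd h2)]

/-- A word with nonzero product of the `A_i` is reduced, and the product is `A_w`. -/
theorem A_wordProd {a : List (ZMod n)} (ha : (a.map gen).prod ≠ 0) :
    A ((cs n).wordProd a) = (a.map gen).prod ∧
      (cs n).length ((cs n).wordProd a) = a.length := by
  obtain ⟨b, hb, hw, hA⟩ := A_spec ((cs n).wordProd a)
  have hl : (cs n).length ((cs n).wordProd a) = b.length := by rw [hw]; exact hb
  have hle : b.length ≤ a.length := hl ▸ (cs n).length_wordProd_le a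
  have hba : b.length = a.length := by
    refine hle.antisymm (not_lt.1 fun hlt => ha ?_)
    exact prod_gen_eq_zero_of_shorter hw hlt
  exact ⟨hA.trans (prod_gen_eq_of_wordProd_eq hw hba.symm).symm, hl.trans hba⟩

end

/-! ### Words without repeated letters -/

/-- Insertion of a letter into a set of letters, undefined if the letter is there already. -/
def insertLetter (i : ZMod n) : Function.End (Option (Finset (ZMod n))) :=
  fun x => x.bind fun J => if i ∈ J then none else some (insert i J)

theorem insertLetter_mul_self (i : ZMod n) (x : Option (Finset (ZMod n))) :
    insertLetter i (insertLetter i x) = none := by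
  cases x with
  | none => rfl
  | some J => by_cases h : i ∈ J <;> simp [insertLetter, h]

theorem insertLetter_comm (i j : ZMod n) (x : Option (Finset (ZMod n))) :
    insertLetter i (insertLetter j x) = insertLetter j (insertLetter i x) := by
  cases x with
  | none => rfl
  | some J =>
    by_cases hij : i = j
    · rw [hij]
    · by_cases h : i ∈ J <;> by_cases h' : j ∈ J <;>
        simp [insertLetter, h, h', hij, Ne.symm hij, Finset.insert_comm]

/-- The action of the braid monoid on sets of letters by insertion. Dead classes act as undefined,
while a word with distinct letters takes the empty set to its set of letters. -/
def supportAct (n : ℕ) : BraidMonoid n →* Function.End (Option (Finset (ZMod n))) :=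
  BraidMonoid.lift insertLetter (fun i j _ => funext fun x => insertLetter_comm i j x)
    (fun i j _ => by
      funext x
      change insertLetter i (insertLetter j (insertLetter i x)) =
        insertLetter j (insertLetter i (insertLetter j x))
      rw [insertLetter_comm j i x, insertLetter_mul_self, insertLetter_comm i j x,
        insertLetter_mul_self])

theorem supportAct_letter (i : ZMod n) : supportAct n (letter i) = insertLetter i :=
  lift_letter _ _ _ i

theorem supportAct_none (q : BraidMonoid n) : supportAct n q none = none := by
  induction q using BraidMonoid.induction with
  | h_one => rw [map_one]; rfl
  | h_letter i q hq =>
    rw [map_mul, supportAct_letter]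
    exact congrArg (insertLetter i) hq

theorem supportAct_of_dead {q : BraidMonoid n} (h : Dead q) (x : Option (Finset (ZMod n))) :
    supportAct n q x = none := by
  obtain ⟨a, b, i, rfl⟩ := h
  rw [map_mul, map_mul, map_mul, supportAct_letter]
  change supportAct n a (insertLetter i (insertLetter i (supportAct n b x))) = none
  rw [insertLetter_mul_self, supportAct_none]

theorem supportAct_wordClass {a : List (ZMod n)} (h : a.Nodup) :
    supportAct n (wordClass a) (some ∅) = some a.toFinset := by
  induction a with
  | nil => rw [wordClass, List.map_nil, List.prod_nil, map_one]; rfl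
  | cons i a ih =>
    rw [List.nodup_cons] at h
    rw [wordClass, List.map_cons, List.prod_cons, map_mul, List.toFinset_cons, supportAct_letter]
    change insertLetter i (supportAct n (wordClass a) (some ∅)) = _
    rw [ih h.2]
    simp [insertLetter, h.1]

theorem not_dead_of_nodup {a : List (ZMod n)} (h : a.Nodup) : ¬ Dead (wordClass a) := by
  intro hd
  have := supportAct_wordClass h
  rw [supportAct_of_dead hd] at this
  exact absurd this (by simp)

theorem prod_gen_ne_zero [n.AtLeastTwo] {a : List (ZMod n)} (h : a.Nodup) :
    (a.map gen).prod ≠ 0 := by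
  intro h0
  refine not_dead_of_nodup h (dead_of_coeff (one_ne_zero (α := Scalars n)) ?_)
  rw [h0, smul_zero, map_zero]; rfl

theorem toFinset_eq_of_prod_gen_eq [n.AtLeastTwo] {a b : List (ZMod n)} (ha : a.Nodup)
    (hb : b.Nodup) (h : (a.map gen).prod = (b.map gen).prod) : a.toFinset = b.toFinset := by
  by_cases hq : wordClass a = wordClass b
  · have := supportAct_wordClass ha
    rw [hq, supportAct_wordClass hb] at this
    exact (Option.some.inj this).symm
  · refine absurd (dead_of_coeff (one_ne_zero (α := Scalars n)) ?_) (not_dead_of_nodup ha)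
    rw [one_smul, h, toModule_apply_of_ne (Ne.symm hq)]

/-! ### Cyclically decreasing words -/

/-- A word is cyclically decreasing if its letters are distinct and no letter `x` is followed, at
any distance, by `x + 1`. -/
theorem cyclicallyDecreasingWord_iff [n.AtLeastTwo] (a : List (ZMod n)) :
    CyclicallyDecreasingWord a ↔ a.Nodup ∧ a.Pairwise fun x y => y ≠ x + 1 := by
  refine and_congr_right fun hn => ?_
  rw [List.pairwise_iff_getElem]
  constructor
  · intro h p q hp hq hpq he
    have := h a[p] (List.getElem_mem hp) (he ▸ List.getElem_mem hq)
    rw [← he, hn.idxOf_getElem, hn.idxOf_getElem] at this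
    omega
  · intro h i hi hi'
    have hp := List.idxOf_lt_length_iff.2 hi
    have hq := List.idxOf_lt_length_iff.2 hi'
    by_contra hlt
    rcases (not_lt.1 hlt).lt_or_eq with hlt | he
    · apply h _ _ hp hq hlt
      rw [List.getElem_idxOf, List.getElem_idxOf]
    · have h1 : a[a.idxOf i] = i := List.getElem_idxOf hp
      have h2 : a[a.idxOf (i + 1)] = i + 1 := List.getElem_idxOf hq
      simp only [he] at h1
      rw [h1] at h2
      exact one_ne_zero' (n := n) (by simpa using h2.symm)

/-- Commuting letters past each other, a word with distinct letters and without ascents `x, x + 1`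
is brought into the order of any list `L` with these properties that contains its letters. -/
theorem prod_map_eq_of_no_ascent {M : Type*} [Monoid M] (f : ZMod n → M)
    (hf : ∀ i j, i ≠ j → j ≠ i + 1 → i ≠ j + 1 → f i * f j = f j * f i)
    (I : Finset (ZMod n)) {L : List (ZMod n)} (hL : L.Nodup)
    (hL' : L.Pairwise fun x y => y ≠ x + 1) {a : List (ZMod n)} (ha : a.Nodup)
    (ha' : a.Pairwise fun x y => y ≠ x + 1) (hsub : a ⊆ L) (hI : ∀ x ∈ L, x ∈ I ↔ x ∈ a) :
    (a.map f).prod = ((L.filter (· ∈ I)).map f).prod := by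
  induction L generalizing a with
  | nil => rw [List.subset_nil.1 hsub]; rfl
  | cons m L ih =>
    rw [List.nodup_cons] at hL
    rw [List.pairwise_cons] at hL'
    by_cases hm : m ∈ a
    · obtain ⟨u, v, rfl⟩ := List.append_of_mem hm
      have hmI : m ∈ I := (hI m List.mem_cons_self).2 hm
      have hsl : List.Sublist (u ++ v) (u ++ m :: v) :=
        List.Sublist.append_left (List.sublist_cons_self m v) u
      have hmuv : m ∉ u ++ v := (List.nodup_middle.1 ha).notMem
      have hsub' : u ++ v ⊆ L := fun x hx => by
        rcases List.mem_cons.1 (hsub (hsl.subset hx)) with rfl | h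
        · exact absurd hx hmuv
        · exact h
      -- the letters before `m` commute with it: `m - 1` comes later, and `m + 1` is not in `L`
      have hcomm : Commute (u.map f).prod (f m) := by
        refine Commute.list_prod_left _ _ fun y hy => ?_
        obtain ⟨x, hx, rfl⟩ := List.mem_map.1 hy
        have hxuv : x ∈ u ++ v := List.mem_append_left _ hx
        refine hf x m (fun h => hmuv (h ▸ hxuv)) ?_ (hL'.1 x (hsub' hxuv))
        exact (List.pairwise_append.1 ha').2.2 x hx m List.mem_cons_self
      have := ih hL.2 hL'.2 (ha.sublist hsl) (ha'.sublist hsl) hsub' (fun x hx => by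
        rw [hI x (List.mem_cons_of_mem _ hx)]
        have : x ≠ m := fun h => hL.1 (h ▸ hx)
        simp [this])
      rw [List.filter_cons_of_pos (by simpa using hmI), List.map_cons, List.prod_cons, ← this,
        List.map_append, List.map_append, List.prod_append, List.prod_append, List.map_cons,
        List.prod_cons, ← mul_assoc, hcomm.eq, mul_assoc]
    · have hmI : m ∉ I := fun h => hm ((hI m List.mem_cons_self).1 h)
      rw [List.filter_cons_of_neg (by simpa using hmI)]
      refine ih hL.2 hL'.2 ha ha' (fun x hx => ?_) fun x hx => hI x (List.mem_cons_of_mem _ hx)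
      rcases List.mem_cons.1 (hsub hx) with rfl | h
      · exact absurd hx hm
      · exact h

/-- The word `c - 1, c - 2, …, c - k` in `ℤ/n`. -/
def downFrom (c : ZMod n) (k : ℕ) : List (ZMod n) := (List.range k).map fun j : ℕ => c - 1 - j

theorem downFrom_succ (c : ZMod n) (k : ℕ) :
    downFrom c (k + 1) = downFrom c k ++ [c - 1 - (k : ZMod n)] := by
  rw [downFrom, List.range_succ, List.map_append]; rfl

theorem natCast_ne_natCast {j k : ℕ} (h : j < k) (hk : k < j + n) : (j : ZMod n) ≠ k := by
  intro he
  rw [ZMod.natCast_eq_natCast_iff] at he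
  have := (Nat.modEq_iff_dvd' h.le).1 he
  have := Nat.le_of_dvd (by omega) this
  omega

theorem downFrom_nodup (c : ZMod n) {k : ℕ} (hk : k ≤ n) : (downFrom c k).Nodup := by
  rw [downFrom, List.nodup_iff_pairwise_ne, List.pairwise_map]
  refine List.Pairwise.imp_of_mem ?_ List.pairwise_lt_range
  intro i j hi hj hij he
  rw [List.mem_range] at hi hj
  exact natCast_ne_natCast hij (by omega) (sub_right_injective he)

theorem downFrom_pairwise (c : ZMod n) {k : ℕ} (hk : k + 1 ≤ n) :
    (downFrom c k).Pairwise fun x y => y ≠ x + 1 := by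
  rw [downFrom, List.pairwise_map]
  refine List.Pairwise.imp_of_mem ?_ List.pairwise_lt_range
  intro i j hi hj hij he
  rw [List.mem_range] at hi hj
  refine natCast_ne_natCast (n := n) (j := i) (k := j + 1) (by omega) (by omega) ?_
  push_cast
  linear_combination he

theorem mem_downFrom_iff [n.AtLeastTwo] (c x : ZMod n) : x ∈ downFrom c (n - 1) ↔ x ≠ c := by
  have hn : 2 ≤ n := Nat.AtLeastTwo.prop
  rw [downFrom, List.mem_map]
  constructor
  · rintro ⟨j, hj, rfl⟩ he
    rw [List.mem_range] at hj
    refine natCast_ne_natCast (n := n) (j := 0) (k := j + 1) (by omega) (by omega) ?_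
    push_cast
    linear_combination he
  · intro hx
    have hlt := ZMod.val_lt (c - 1 - x)
    refine ⟨(c - 1 - x).val, List.mem_range.2 ?_, by rw [ZMod.natCast_zmod_val]; ring⟩
    by_contra hge
    have hv : (c - 1 - x).val + 1 = n := by omega
    have := congrArg (Nat.cast (R := ZMod n)) hv
    rw [Nat.cast_add, ZMod.natCast_zmod_val, ZMod.natCast_self, Nat.cast_one] at this
    exact hx (by linear_combination -this)

/-- The cyclically decreasing word with set of letters `I`, where `c` is not in `I`. -/
def cutWord (c : ZMod n) (I : Finset (ZMod n)) : List (ZMod n) :=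
  (downFrom c (n - 1)).filter (· ∈ I)

/-- A cyclically decreasing word with set of letters `I`, for a proper subset `I` of `ℤ/n`. The cut
point is an arbitrary element outside `I`. -/
noncomputable def setWord (I : Finset (ZMod n)) : List (ZMod n) :=
  cutWord (Classical.epsilon (· ∉ I)) I

/-- The product of the `A_i` along the cyclically decreasing word with set of letters `I`. -/
noncomputable def setProd (I : Finset (ZMod n)) : NilHecke n := ((setWord I).map gen).prod

theorem cutWord_nodup (c : ZMod n) (I : Finset (ZMod n)) : (cutWord c I).Nodup :=
  (downFrom_nodup c (Nat.sub_le n 1)).filter _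

theorem epsilon_notMem {I : Finset (ZMod n)} (hI : ∃ c, c ∉ I) :
    Classical.epsilon (· ∉ I) ∉ I := Classical.epsilon_spec (p := (· ∉ I)) hI

theorem wordProd_simple_comm (i j : ZMod n) (h : coxMatrix n i j = 2) :
    (cs n).simple i * (cs n).simple j = (cs n).simple j * (cs n).simple i := by
  have := (cs n).simple_mul_simple_pow i j
  rw [h, pow_two] at this
  have h2 := mul_eq_one_iff_eq_inv.1 this
  rwa [mul_inv_rev, (cs n).inv_simple, (cs n).inv_simple] at h2

section
variable [n.AtLeastTwo]

theorem cutWord_pairwise (c : ZMod n) (I : Finset (ZMod n)) :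
    (cutWord c I).Pairwise fun x y => y ≠ x + 1 := by
  have hn : 2 ≤ n := Nat.AtLeastTwo.prop
  exact (downFrom_pairwise c (by omega)).filter _

theorem mem_cutWord {c : ZMod n} {I : Finset (ZMod n)} (hc : c ∉ I) (x : ZMod n) :
    x ∈ cutWord c I ↔ x ∈ I := by
  rw [cutWord, List.mem_filter, mem_downFrom_iff]
  simp only [decide_eq_true_eq, and_iff_right_iff_imp]
  rintro hx rfl
  exact hc hx

theorem cutWord_toFinset {c : ZMod n} {I : Finset (ZMod n)} (hc : c ∉ I) :
    (cutWord c I).toFinset = I := by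
  ext x
  rw [List.mem_toFinset, mem_cutWord hc]

theorem cutWord_length {c : ZMod n} {I : Finset (ZMod n)} (hc : c ∉ I) :
    (cutWord c I).length = I.card := by
  rw [← List.toFinset_card_of_nodup (cutWord_nodup c I), cutWord_toFinset hc]

/-- A cyclically decreasing word agrees with the cut word with the same letters, up to commutation
moves. -/
theorem prod_cyclicallyDecreasing {M : Type*} [Monoid M] (f : ZMod n → M)
    (hf : ∀ i j, coxMatrix n i j = 2 → f i * f j = f j * f i) {a : List (ZMod n)}
    (ha : CyclicallyDecreasingWord a) {c : ZMod n} (hc : c ∉ a) :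
    (a.map f).prod = ((cutWord c a.toFinset).map f).prod := by
  have hn : 2 ≤ n := Nat.AtLeastTwo.prop
  rw [cyclicallyDecreasingWord_iff] at ha
  refine prod_map_eq_of_no_ascent f (fun i j h1 h2 h3 => ?_) _
    (downFrom_nodup c (Nat.sub_le n 1)) (downFrom_pairwise c (by omega)) ha.1 ha.2
    (fun x hx => (mem_downFrom_iff c x).2 fun h => hc (h ▸ hx)) fun x _ => List.mem_toFinset
  refine hf i j ?_
  change (if i = j then 1 else if n = 2 then 0 else if j = i + 1 ∨ i = j + 1 then 3 else 2) = 2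
  rw [if_neg h1, if_neg, if_neg (by tauto)]
  -- for `n = 2` any two distinct elements of `ℤ/n` are adjacent
  rintro rfl
  revert i j
  decide

theorem cyclicallyDecreasingWord_cutWord (c : ZMod n) (I : Finset (ZMod n)) :
    CyclicallyDecreasingWord (cutWord c I) :=
  (cyclicallyDecreasingWord_iff _).2 ⟨cutWord_nodup c I, cutWord_pairwise c I⟩

theorem prod_eq_setWord {M : Type*} [Monoid M] (f : ZMod n → M)
    (hf : ∀ i j, coxMatrix n i j = 2 → f i * f j = f j * f i) {a : List (ZMod n)}
    (ha : CyclicallyDecreasingWord a) (hc : ∃ c, c ∉ a.toFinset) :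
    (a.map f).prod = ((setWord a.toFinset).map f).prod :=
  prod_cyclicallyDecreasing f hf ha fun h => epsilon_notMem hc (List.mem_toFinset.2 h)

theorem setProd_eq_cutWord {c : ZMod n} {I : Finset (ZMod n)} (hc : c ∉ I) :
    setProd I = ((cutWord c I).map gen).prod := by
  have := prod_eq_setWord gen gen_comm (cyclicallyDecreasingWord_cutWord c I)
    ⟨c, by rwa [cutWord_toFinset hc]⟩
  rw [this, cutWord_toFinset hc, setProd]

/-- The letters of a cyclically decreasing word do not exhaust `ℤ/n`, as no letter can come
first. -/
theorem exists_notMem_of_cyclicallyDecreasingWord {a : List (ZMod n)}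
    (ha : CyclicallyDecreasingWord a) : ∃ c, c ∉ a.toFinset := by
  by_contra! h
  simp only [List.mem_toFinset] at h
  obtain ⟨x, l, rfl⟩ := List.exists_cons_of_ne_nil (List.ne_nil_of_mem (h 0))
  have := ha.2 x (h _) (h _)
  simp at this

/-- The cyclically decreasing elements of length `i < n` correspond to the sets of `i` letters. -/
theorem h_eq_sum_setProd (i : ℕ) (hi : i < n) :
    h n i = ∑ I ∈ Finset.powersetCard i Finset.univ, setProd (n := n) I := by
  have hc : ∀ I ∈ Finset.powersetCard i (Finset.univ : Finset (ZMod n)), ∃ c, c ∉ I := by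
    intro I hI
    by_contra! h
    have := (Finset.mem_powersetCard.1 hI).2
    rw [(Finset.eq_univ_iff_forall.2 h), Finset.card_univ, ZMod.card] at this
    omega
  have hne : ∀ I : Finset (ZMod n), ((setWord I).map gen).prod ≠ 0 := fun I =>
    prod_gen_ne_zero (cutWord_nodup _ I)
  rw [h]
  symm
  refine Finset.sum_nbij (fun I => (cs n).wordProd (setWord I)) ?_ ?_ ?_ ?_
  · intro I hI
    rw [Set.Finite.mem_toFinset]
    refine ⟨⟨_, cyclicallyDecreasingWord_cutWord _ I, rfl⟩, ?_⟩
    rw [(A_wordProd (hne I)).2, setWord, cutWord_length (epsilon_notMem (hc I hI))]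
    exact (Finset.mem_powersetCard.1 hI).2
  · intro I hI J hJ he
    have h1 := (A_wordProd (hne I)).1
    have he' : (cs n).wordProd (setWord I) = (cs n).wordProd (setWord J) := he
    rw [he', (A_wordProd (hne J)).1] at h1
    have := toFinset_eq_of_prod_gen_eq (cutWord_nodup _ J) (cutWord_nodup _ I) h1
    rw [cutWord_toFinset (epsilon_notMem (hc I hI)),
      cutWord_toFinset (epsilon_notMem (hc J hJ))] at this
    exact this.symm
  · intro w hw
    obtain ⟨⟨a, ha, rfl⟩, hl⟩ := (Set.Finite.mem_toFinset _).1 hw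
    refine ⟨a.toFinset, Finset.mem_coe.2 (Finset.mem_powersetCard.2 ⟨Finset.subset_univ _, ?_⟩), ?_⟩
    · rw [List.toFinset_card_of_nodup ha.1, ← (A_wordProd (prod_gen_ne_zero ha.1)).2]
      exact hl
    · exact (prod_eq_setWord _ wordProd_simple_comm ha
        (exists_notMem_of_cyclicallyDecreasingWord ha)).symm
  · intro I hI
    exact (A_wordProd (hne I)).1.symm

end

/-! ### Translations and their interpolation -/

/-- The weight `ε_c` as a scalar. -/
noncomputable def epsS (c : ZMod n) : Scalars n := SymmetricAlgebra.ι ℤ (Weight n) (eps c)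

/-- The classes of the coordinate vectors generate the weight lattice. -/
theorem weight_hom_ext [NeZero n] {f g : Weight n →ₗ[ℤ] Weight n}
    (h : ∀ c, f (eps c) = g (eps c)) : f = g := by
  refine Submodule.linearMap_qext _ (LinearMap.pi_ext' fun c => LinearMap.ext_ring ?_)
  exact h c

open Polynomial in
/-- The polynomial with roots `ε_j`, `j ∈ I`. -/
noncomputable def rootPoly (I : Finset (ZMod n)) : (Scalars n)[X] := ∏ j ∈ I, (X - C (epsS j))

theorem rootPoly_monic (I : Finset (ZMod n)) : (rootPoly I).Monic :=
  Polynomial.monic_prod_X_sub_C _ _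

theorem rootPoly_natDegree (I : Finset (ZMod n)) : (rootPoly I).natDegree = I.card :=
  Polynomial.natDegree_finsetProd_X_sub_C_eq_card _ _

open Polynomial in
theorem rootPoly_map (I : Finset (ZMod n)) :
    (rootPoly I).map (evalZero n : Scalars n →+* ℤ) = X ^ I.card := by
  have : ∀ j : ZMod n, evalZero n (epsS j) = 0 := fun j => SymmetricAlgebra.lift_ι_apply _ _
  simp [rootPoly, Polynomial.map_prod, this]

theorem epsS_injective : Function.Injective (epsS (n := n)) := ι_eps_injective

section
variable [n.AtLeastTwo]

/-- Along `r_{c-1} ⋯ r_{c-m}` the weights `ε_{c-j}` are permuted cyclically for `j ≤ m` and fixed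
for larger `j`. -/
theorem reflWord_downFrom_eps (c : ZMod n) {m : ℕ} (hm : m < n) {j : ℕ} (hj : j < n) :
    reflWord (downFrom c m) (eps (c - (j : ZMod n))) =
      if j < m then eps (c - (j : ZMod n) - 1) else
        if j = m then eps c else eps (c - (j : ZMod n)) := by
  induction m generalizing j with
  | zero =>
    rcases Nat.eq_zero_or_pos j with rfl | hj0
    · simp [downFrom, reflWord]
    · simp [downFrom, reflWord, hj0.ne']
  | succ m ih =>
    have hs : ∀ l, reflWord [c - 1 - (m : ZMod n)] l = refl (c - 1 - (m : ZMod n)) l := fun l => by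
      rw [reflWord_cons]; rfl
    rw [downFrom_succ, reflWord_append, hs]
    have e1 : c - (m : ZMod n) = c - 1 - (m : ZMod n) + 1 := by ring
    have e2 : c - ((m + 1 : ℕ) : ZMod n) = c - 1 - (m : ZMod n) := by push_cast; ring
    rcases lt_trichotomy j m with h | rfl | h
    · rw [refl_eps_of_ne, ih (by omega) hj, if_pos h, if_pos (by omega)]
      · rw [← e2]
        exact fun he => natCast_ne_natCast (n := n) (j := j) (k := m + 1) (by omega) (by omega)
          (sub_right_injective he)
      · rw [← e1]
        exact fun he => natCast_ne_natCast (n := n) h (by omega) (sub_right_injective he)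
    · rw [e1, refl_eps_succ, ← e2, ih (by omega) hm, if_neg (by omega), if_neg (by omega),
        if_pos (Nat.lt_succ_self _)]
      congr 1
      push_cast
      ring
    · rcases Nat.lt_or_eq_of_le (Nat.succ_le_of_lt h) with h' | rfl
      · rw [refl_eps_of_ne, ih (by omega) hj, if_neg (by omega), if_neg (by omega),
          if_neg (by omega), if_neg (by omega)]
        · rw [← e2]
          exact fun he => natCast_ne_natCast (n := n) (j := m + 1) (k := j) (by omega) (by omega)
            (sub_right_injective he.symm)
        · rw [← e1]
          exact fun he => natCast_ne_natCast (n := n) h (by omega) (sub_right_injective he.symm)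
      · rw [Nat.succ_eq_add_one, e2, refl_eps_self, ← e1, ih (by omega) (by omega),
          if_neg (lt_irrefl _), if_pos rfl, if_neg (lt_irrefl _), if_pos rfl]

theorem reflWord_downFrom_full (c k : ZMod n) :
    reflWord (downFrom c (n - 1)) (eps k) = eps (k - 1) := by
  have hn : 2 ≤ n := Nat.AtLeastTwo.prop
  have hk : k = c - ((c - k).val : ZMod n) := by rw [ZMod.natCast_zmod_val]; ring
  have hlt := ZMod.val_lt (c - k)
  rw [hk, reflWord_downFrom_eps c (by omega) hlt]
  split_ifs with h1 h2
  · rfl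
  · rw [h2, Nat.cast_sub (by omega), ZMod.natCast_self]
    congr 1
    push_cast
    ring
  · omega

/-- The element of the affine symmetric group, as a group inside the nilHecke ring, given by the
longest cyclically decreasing word that avoids the letter `c`. Up to a rotation independent of `c`
it is a translation. -/
noncomputable def transl (c : ZMod n) : NilHecke n := ((downFrom c (n - 1)).map simpleRefl).prod

/-- The rotation `ε_k ↦ ε_{k-1}` of the weight lattice. -/
def rotate (n : ℕ) : Weight n →ₗ[ℤ] Weight n := reflWord (downFrom 0 (n - 1))

theorem transl_mul_wt (c : ZMod n) (l : Weight n) :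
    transl c * wt l = wt (rotate n l) * transl c := by
  have : reflWord (downFrom c (n - 1)) = rotate n :=
    weight_hom_ext fun k => by rw [rotate, reflWord_downFrom_full, reflWord_downFrom_full]
  rw [transl, simpleRefl_prod_wt, this]

/-- The expansion of `r_{c-1} ⋯ r_{c-k}` into products of the `A_i`. -/
theorem prod_simpleRefl_downFrom (c : ZMod n) {k : ℕ} (hk : k < n) :
    ((downFrom c k).map simpleRefl).prod = ∑ I ∈ (downFrom c k).toFinset.powerset,
      (∏ j ∈ I, (epsS c - epsS j)) • (((downFrom c k).filter (· ∈ I)).map gen).prod := by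
  induction k with
  | zero => simp [downFrom]
  | succ k ih =>
    have hnd := downFrom_nodup c (k := k + 1) (by omega)
    rw [downFrom_succ] at hnd
    set m := c - 1 - (k : ZMod n) with hm
    set L := downFrom c k with hL
    have hmL : m ∉ L := by
      have := (List.nodup_append.1 hnd).2.2
      exact fun h => this m h m (List.mem_singleton_self m) rfl
    -- the preceding reflections fix `ε_m` and move `ε_{m+1}` up to `ε_c`
    have hroot : reflWord L (root m) = eps m - eps c := by
      have e1 : m + 1 = c - (k : ZMod n) := by rw [hm]; ring
      have e2 : m = c - ((k + 1 : ℕ) : ZMod n) := by rw [hm]; push_cast; ring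
      rw [root_eq_eps, map_sub, e1, reflWord_downFrom_eps c (by omega) (by omega),
        if_neg (lt_irrefl _), if_pos rfl, e2, reflWord_downFrom_eps c (by omega) hk,
        if_neg (by omega), if_neg (by omega)]
    rw [downFrom_succ, ← hm, ← hL, List.map_append, List.prod_append, List.map_singleton,
      List.prod_singleton, simpleRefl, mul_sub, mul_one, ← mul_assoc, simpleRefl_prod_wt, hroot,
      List.toFinset_append, Finset.union_comm, List.toFinset_cons, List.toFinset_nil,
      Finset.insert_union, Finset.empty_union, Finset.sum_powerset_insert (by simpa using hmL),
      mul_assoc, ← ι_smul, sub_eq_add_neg, ← neg_smul, ← map_neg, neg_sub, map_sub, ih (by omega)]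
    congr 1
    · refine Finset.sum_congr rfl fun I hI => ?_
      have hmI : m ∉ I := fun h => hmL (List.mem_toFinset.1 (Finset.mem_powerset.1 hI h))
      rw [List.filter_append, List.filter_singleton]
      simp [hmI]
    · rw [Finset.sum_mul, Finset.smul_sum]
      refine Finset.sum_congr rfl fun I hI => ?_
      have hmI : m ∉ I := fun h => hmL (List.mem_toFinset.1 (Finset.mem_powerset.1 hI h))
      have hf : L.filter (· ∈ insert m I) = L.filter (· ∈ I) := by
        refine List.filter_congr fun x hx => ?_
        have : x ≠ m := fun h => hmL (h ▸ hx)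
        simp [this]
      rw [List.filter_append, List.filter_singleton, hf]
      simp only [Finset.mem_insert_self, decide_true, cond_true, List.map_append,
        List.prod_append, List.map_singleton, List.prod_singleton]
      rw [Finset.prod_insert hmI, mul_smul, smul_def _ (List.prod _), mul_assoc, ← smul_def]
      rfl

/-- The coefficient of `A_I` is a polynomial in `ε_c` that does not depend on `c` otherwise. -/
theorem transl_eq_sum (c : ZMod n) :
    transl c = ∑ I ∈ Finset.univ.erase (Finset.univ : Finset (ZMod n)),
      (∏ j ∈ I, (epsS c - epsS j)) • setProd I := by
  have hn : 2 ≤ n := Nat.AtLeastTwo.prop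
  have hmem : ∀ I, I ∈ (downFrom c (n - 1)).toFinset.powerset ↔ c ∉ I := by
    intro I
    rw [Finset.mem_powerset]
    constructor
    · intro h hc
      exact (mem_downFrom_iff c c).1 (List.mem_toFinset.1 (h hc)) rfl
    · intro hc x hx
      exact List.mem_toFinset.2 ((mem_downFrom_iff c x).2 fun h => hc (h ▸ hx))
  rw [transl, prod_simpleRefl_downFrom c (by omega)]
  rw [Finset.sum_congr rfl fun I hI => by
    rw [← cutWord, ← setProd_eq_cutWord ((hmem I).1 hI)]]
  refine Finset.sum_subset (fun I hI => ?_) fun I _ hI => ?_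
  · refine Finset.mem_erase.2 ⟨?_, Finset.mem_univ _⟩
    rintro rfl
    exact (hmem _).1 hI (Finset.mem_univ c)
  -- a set that contains `c` has the vanishing factor `ε_c - ε_c`
  · rw [hmem, not_not] at hI
    rw [Finset.prod_eq_zero hI (sub_self (epsS c)), zero_smul]

/-- The coefficients of the polynomial of degree less than `n` that interpolates the elements
`transl c` at the points `ε_c`. -/
noncomputable def hLift (n : ℕ) [NeZero n] (i : ℕ) : NilHecke n :=
  ∑ I ∈ Finset.univ.erase (Finset.univ : Finset (ZMod n)), (rootPoly I).coeff i • setProd I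

theorem transl_eq_interp (c : ZMod n) :
    transl c = ∑ i ∈ Finset.range n, epsS c ^ i • hLift n i := by
  simp only [hLift, Finset.smul_sum]
  rw [transl_eq_sum, Finset.sum_comm]
  refine Finset.sum_congr rfl fun I hI => ?_
  have hlt : (rootPoly I).natDegree < n := by
    rw [rootPoly_natDegree]
    have := Finset.card_lt_univ_of_notMem (s := I) (x := Classical.choose
      (not_forall.1 (mt Finset.eq_univ_iff_forall.2 (Finset.ne_of_mem_erase hI))))
      (Classical.choose_spec (not_forall.1 (mt Finset.eq_univ_iff_forall.2
        (Finset.ne_of_mem_erase hI))))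
    rwa [ZMod.card] at this
  have : ∏ j ∈ I, (epsS c - epsS j) = (rootPoly I).eval (epsS c) := by
    simp [rootPoly, Polynomial.eval_prod]
  rw [this, Polynomial.eval_eq_sum_range' hlt, Finset.sum_smul]
  refine Finset.sum_congr rfl fun i _ => ?_
  rw [mul_comm, mul_smul]

/-- An additive map that specializes the scalars at zero does not distinguish `hLift n i` from
`h n i`. -/
theorem map_hLift {E : Type*} [AddCommGroup E] (G : NilHecke n →+ E)
    (hG : ∀ (s : Scalars n) a, G (s • a) = evalZero n s • G a) {i : ℕ} (hi : i < n) :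
    G (hLift n i) = G (h n i) := by
  have hco : ∀ I : Finset (ZMod n), evalZero n ((rootPoly I).coeff i) =
      if I.card = i then 1 else 0 := by
    intro I
    have := congrArg (fun p => p.coeff i) (rootPoly_map I)
    rw [Polynomial.coeff_map, Polynomial.coeff_X_pow] at this
    simp only [eq_comm (a := I.card)]
    exact this
  rw [hLift, h_eq_sum_setProd i hi, map_sum, map_sum]
  simp only [hG, hco, ite_smul, one_smul, zero_smul]
  rw [← Finset.sum_filter]
  refine Finset.sum_congr ?_ fun _ _ => rfl
  ext I
  simp only [Finset.mem_filter, Finset.mem_erase, Finset.mem_univ, and_true,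
    Finset.mem_powersetCard, Finset.subset_univ, true_and, and_iff_right_iff_imp]
  rintro h rfl
  rw [Finset.card_univ, ZMod.card] at h
  omega

/-- The coefficients of a polynomial of degree less than `n` in `ε_c` with values in a torsion-free
module are determined by its values, by the Vandermonde determinant. -/
theorem interp_unique {E : Type*} [AddCommGroup E] [Module (Scalars n) E]
    [Module.IsTorsionFree (Scalars n) E] {v w : ℕ → E}
    (hvw : ∀ c : ZMod n, ∑ i ∈ Finset.range n, epsS c ^ i • v i =
      ∑ i ∈ Finset.range n, epsS c ^ i • w i) {i : ℕ} (hi : i < n) : v i = w i := by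
  let g : Fin n → Scalars n := fun k => epsS ((k : ℕ) : ZMod n)
  have hg : Function.Injective g := fun k l hkl => by
    have := epsS_injective hkl
    rw [ZMod.natCast_eq_natCast_iff', Nat.mod_eq_of_lt k.2, Nat.mod_eq_of_lt l.2] at this
    exact Fin.ext this
  let V := Matrix.vandermonde g
  have hdet : V.det ≠ 0 := Matrix.det_vandermonde_ne_zero_iff.2 hg
  have h0 : ∀ k : Fin n, ∑ l : Fin n, V k l • (v l - w l) = 0 := by
    intro k
    have := hvw ((k : ℕ) : ZMod n)
    rw [← sub_eq_zero, ← Finset.sum_sub_distrib, Finset.sum_range] at this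
    simp only [← smul_sub] at this
    exact this
  have key : V.det • (v i - w i) = 0 := by
    calc V.det • (v i - w i) = ∑ l : Fin n, (V.adjugate * V) ⟨i, hi⟩ l • (v l - w l) := by
          rw [Matrix.adjugate_mul]
          simp [Matrix.smul_apply, Matrix.one_apply, ite_smul]
      _ = ∑ k : Fin n, V.adjugate ⟨i, hi⟩ k • ∑ l : Fin n, V k l • (v l - w l) := by
          simp only [Matrix.mul_apply, Finset.sum_smul, Finset.smul_sum, mul_smul]
          exact Finset.sum_comm
      _ = 0 := by simp [h0]
  exact sub_eq_zero.1 ((smul_eq_zero.1 key).resolve_left hdet)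

theorem hLift_mul_wt (l : Weight n) {i : ℕ} (hi : i < n) :
    hLift n i * wt l = wt (rotate n l) * hLift n i := by
  refine interp_unique (v := fun i => hLift n i * wt l)
    (w := fun i => wt (rotate n l) * hLift n i) (fun c => ?_) hi
  have := transl_mul_wt c l
  rw [transl_eq_interp, Finset.sum_mul, Finset.mul_sum] at this
  simp only [smul_def, mul_assoc] at this ⊢
  rw [this]
  refine Finset.sum_congr rfl fun j _ => ?_
  rw [← scalar_ι, ← mul_assoc, ← mul_assoc, ← map_mul, ← map_mul, mul_comm]

/-- The simple reflections act diagonally on the tensor square. -/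
theorem coprodAct_simpleRefl_tmul (i : ZMod n) (x y : NilHecke n) :
    coprodAct n (simpleRefl i) (x ⊗ₜ[Scalars n] y) =
      (simpleRefl i * x) ⊗ₜ[Scalars n] (simpleRefl i * y) := by
  have e : coprodAct n (simpleRefl i) (x ⊗ₜ[Scalars n] y) = x ⊗ₜ[Scalars n] y -
      coprodAct n (scalar n (SymmetricAlgebra.ι ℤ (Weight n) (root i)))
        (coprodAct n (gen i) (x ⊗ₜ[Scalars n] y)) := by
    rw [scalar_ι, simpleRefl, map_sub, map_one, map_mul]; rfl
  have e2 : ∀ z : NilHecke n, simpleRefl i * z = z - wt (root i) * (gen i * z) := fun z => by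
    rw [simpleRefl, sub_mul, one_mul, mul_assoc]
  rw [e, coprodAct_scalar, coprodAct_gen, genAct_tmul, smul_add, ← wt_tmul, ← tmul_wt,
    e2 y, TensorProduct.tmul_sub, e2 x, TensorProduct.sub_tmul, TensorProduct.sub_tmul]
  abel

theorem coprodAct_prod_simpleRefl_tmul (a : List (ZMod n)) (x y : NilHecke n) :
    coprodAct n (a.map simpleRefl).prod (x ⊗ₜ[Scalars n] y) =
      ((a.map simpleRefl).prod * x) ⊗ₜ[Scalars n] ((a.map simpleRefl).prod * y) := by
  induction a with
  | nil => simp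
  | cons i a ih =>
    rw [List.map_cons, List.prod_cons, map_mul]
    change coprodAct n (simpleRefl i) (coprodAct n _ _) = _
    rw [ih, coprodAct_simpleRefl_tmul, mul_assoc, mul_assoc]

theorem coprod_transl (c : ZMod n) :
    coprod n (transl c) = transl c ⊗ₜ[Scalars n] transl c := by
  change coprodAct n (transl c) _ = _
  rw [transl, coprodAct_prod_simpleRefl_tmul, mul_one]

theorem coprod_smul (s : Scalars n) (a : NilHecke n) : coprod n (s • a) = s • coprod n a := by
  rw [smul_def, coprod_mul, coprodAct_scalar]

open Polynomial in
/-- The coefficients of `y ^ m` modulo the polynomial with roots `ε_c` for all `c`. -/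
noncomputable def powRed (n : ℕ) [NeZero n] (m i : ℕ) : Scalars n :=
  (X ^ m %ₘ rootPoly (Finset.univ : Finset (ZMod n))).coeff i

open Polynomial in
theorem epsS_pow_eq (c : ZMod n) (m : ℕ) :
    epsS c ^ m = ∑ i ∈ Finset.range n, epsS c ^ i * powRed n m i := by
  have hn : 2 ≤ n := Nat.AtLeastTwo.prop
  have hdeg := rootPoly_natDegree (Finset.univ : Finset (ZMod n))
  rw [Finset.card_univ, ZMod.card] at hdeg
  have hroot : (rootPoly (Finset.univ : Finset (ZMod n))).eval (epsS c) = 0 := by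
    rw [rootPoly, eval_prod]
    exact Finset.prod_eq_zero (Finset.mem_univ c) (by simp)
  have h1 : (X ^ m %ₘ rootPoly (Finset.univ : Finset (ZMod n))).eval (epsS c) = epsS c ^ m := by
    have := congrArg (eval (epsS c))
      (modByMonic_add_div (X ^ m) (rootPoly (Finset.univ : Finset (ZMod n))))
    rwa [eval_add, eval_mul, hroot, zero_mul, add_zero, eval_pow, eval_X] at this
  have hlt : (X ^ m %ₘ rootPoly (Finset.univ : Finset (ZMod n))).natDegree < n := by
    refine lt_of_lt_of_eq (natDegree_modByMonic_lt _ (rootPoly_monic _) fun h => ?_) hdeg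
    rw [h, natDegree_one] at hdeg
    omega
  rw [← h1, eval_eq_sum_range' hlt]
  refine Finset.sum_congr rfl fun i _ => ?_
  rw [powRed, mul_comm]

open Polynomial in
/-- At zero the modulus becomes `y ^ n`. -/
theorem evalZero_powRed (m : ℕ) {i : ℕ} (hi : i < n) :
    evalZero n (powRed n m i) = if m = i then 1 else 0 := by
  have h1 : evalZero n (powRed n m i) = ((X ^ m : ℤ[X]) %ₘ X ^ n).coeff i := by
    have := congrArg (fun p => p.coeff i) (map_modByMonic (evalZero n : Scalars n →+* ℤ)
      (p := X ^ m) (rootPoly_monic (Finset.univ : Finset (ZMod n))))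
    simp only [coeff_map, rootPoly_map, Polynomial.map_pow, map_X] at this
    rwa [Finset.card_univ, ZMod.card] at this
  rw [h1]
  rcases lt_or_ge m n with hm | hm
  · rw [(modByMonic_eq_self_iff (monic_X_pow n)).2 (by
      rw [degree_X_pow, degree_X_pow]; exact_mod_cast hm), coeff_X_pow]
    simp only [eq_comm]
  · rw [(modByMonic_eq_zero_iff_dvd (monic_X_pow n)).2 (pow_dvd_pow X hm), coeff_zero, if_neg]
    omega

/-- As the elements `transl c` are group-like, so is their interpolating polynomial, modulo the
polynomial with roots `ε_c` for all `c`. -/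
theorem coprod_hLift {i : ℕ} (hi : i < n) :
    coprod n (hLift n i) = ∑ j ∈ Finset.range n, ∑ k ∈ Finset.range n,
      powRed n (j + k) i • (hLift n j ⊗ₜ[Scalars n] hLift n k) := by
  refine interp_unique (v := fun i => coprod n (hLift n i)) (w := fun i =>
    ∑ j ∈ Finset.range n, ∑ k ∈ Finset.range n,
      powRed n (j + k) i • (hLift n j ⊗ₜ[Scalars n] hLift n k)) (fun c => ?_) hi
  have h1 := coprod_transl c
  rw [transl_eq_interp, map_sum, TensorProduct.sum_tmul] at h1
  simp only [coprod_smul, TensorProduct.tmul_sum, TensorProduct.smul_tmul_smul, ← pow_add] at h1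
  rw [h1]
  simp only [Finset.smul_sum, smul_smul]
  rw [Finset.sum_comm (s := Finset.range n) (t := Finset.range n)
    (f := fun i j => ∑ k ∈ Finset.range n,
      (epsS c ^ i * powRed n (j + k) i) • (hLift n j ⊗ₜ[Scalars n] hLift n k))]
  refine Finset.sum_congr rfl fun j _ => ?_
  rw [Finset.sum_comm]
  refine Finset.sum_congr rfl fun k _ => ?_
  rw [epsS_pow_eq, Finset.sum_smul]

end

/-! ### The specialized coproduct -/

theorem braidProd_mem (q : BraidMonoid n) : braidProd n q ∈ nilCoxeter n := by
  induction q using BraidMonoid.induction with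
  | h_one => rw [map_one]; exact one_mem _
  | h_letter i q hq =>
    rw [map_mul]
    exact mul_mem (gen_mem i) hq

theorem evalZero_ι (l : Weight n) : evalZero n (SymmetricAlgebra.ι ℤ (Weight n) l) = 0 :=
  SymmetricAlgebra.lift_ι_apply _ _

section
variable [n.AtLeastTwo]

/-- The nilHecke ring is spanned by the nilCoxeter algebra over the scalars. -/
theorem NilHecke.span_induction {p : NilHecke n → Prop} (h_zero : p 0)
    (h_add : ∀ x y, p x → p y → p (x + y))
    (h_smul : ∀ (s : Scalars n) (a : nilCoxeter n), p (s • (a : NilHecke n)))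
    (x : NilHecke n) : p x := by
  rw [← fromModule_toModule x]
  induction toModule n x using Finsupp.induction_linear with
  | zero => rw [map_zero]; exact h_zero
  | add m m' h h' => rw [map_add]; exact h_add _ _ h h'
  | single q s =>
    rw [fromModule, Finsupp.linearCombination_single]
    exact h_smul s ⟨_, braidProd_mem q⟩

theorem tensor_span_induction {p : NilHecke n ⊗[Scalars n] NilHecke n → Prop} (h_zero : p 0)
    (h_add : ∀ x y, p x → p y → p (x + y))
    (h_smul : ∀ (s : Scalars n) (a b : nilCoxeter n),
      p (s • ((a : NilHecke n) ⊗ₜ[Scalars n] (b : NilHecke n))))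
    (t : NilHecke n ⊗[Scalars n] NilHecke n) : p t := by
  induction t using TensorProduct.induction_on with
  | zero => exact h_zero
  | add x y hx hy => exact h_add x y hx hy
  | tmul x y =>
    induction x using NilHecke.span_induction with
    | h_zero => rw [TensorProduct.zero_tmul]; exact h_zero
    | h_add x x' hx hx' => rw [TensorProduct.add_tmul]; exact h_add _ _ hx hx'
    | h_smul s a =>
      induction y using NilHecke.span_induction with
      | h_zero => rw [TensorProduct.tmul_zero]; exact h_zero
      | h_add y y' hy hy' => rw [TensorProduct.tmul_add]; exact h_add _ _ hy hy'
      | h_smul s' b => rw [TensorProduct.smul_tmul_smul]; exact h_smul _ a b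

end

/-- Right multiplication in the nilHecke ring, a linear map over the scalars. -/
noncomputable def mulRightLin (x : NilHecke n) : NilHecke n →ₗ[Scalars n] NilHecke n where
  toFun a := a * x
  map_add' a b := add_mul a b x
  map_smul' s a := by rw [smul_def, mul_assoc]; rfl

/-- Right multiplication by `x ⊗ y`. -/
noncomputable def tensorMulRight (x y : NilHecke n) :
    NilHecke n ⊗[Scalars n] NilHecke n →ₗ[Scalars n] NilHecke n ⊗[Scalars n] NilHecke n :=
  TensorProduct.map (mulRightLin x) (mulRightLin y)

theorem tensorMulRight_tmul (x y u v : NilHecke n) :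
    tensorMulRight x y (u ⊗ₜ[Scalars n] v) = (u * x) ⊗ₜ[Scalars n] (v * y) := rfl

section
variable [n.AtLeastTwo]

/-- Right multiplication commutes with the action by which the coproduct is defined. -/
theorem coprodAct_tensorMulRight (a x y : NilHecke n) (t : NilHecke n ⊗[Scalars n] NilHecke n) :
    coprodAct n a (tensorMulRight x y t) = tensorMulRight x y (coprodAct n a t) := by
  induction a using NilHecke.induction generalizing t with
  | h_neg_one => rw [map_neg, map_one]; exact (map_neg (tensorMulRight x y) t).symm
  | h_gen i =>
    rw [coprodAct_gen]
    induction t using TensorProduct.induction_on with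
    | zero => simp
    | add t t' h h' => simp only [map_add, h, h']
    | tmul u v =>
      rw [tensorMulRight_tmul, genAct_tmul, genAct_tmul, map_add, tensorMulRight_tmul,
        tensorMulRight_tmul]
      simp only [mul_assoc]
  | h_wt l => rw [← scalar_ι, coprodAct_scalar, coprodAct_scalar, map_smul]
  | h_add a b ha hb =>
    rw [map_add]
    change coprodAct n a _ + coprodAct n b _ =
      tensorMulRight x y (coprodAct n a t + coprodAct n b t)
    rw [ha, hb, map_add]
  | h_mul a b ha hb =>
    rw [map_mul]
    change coprodAct n a (coprodAct n b _) = tensorMulRight x y (coprodAct n a (coprodAct n b t))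
    rw [hb, ha]

theorem coprodAct_tmul (a x y : NilHecke n) :
    coprodAct n a (x ⊗ₜ[Scalars n] y) = tensorMulRight x y (coprod n a) := by
  refine Eq.trans ?_ (coprodAct_tensorMulRight a x y (1 ⊗ₜ[Scalars n] 1))
  rw [tensorMulRight_tmul, one_mul, one_mul]

/-- The specialization is linear over the nilCoxeter algebra from the right. -/
theorem phi_mul_coe (x : NilHecke n) (b : nilCoxeter n) :
    phi n (x * (b : NilHecke n)) = phi n x * b := by
  induction x using NilHecke.span_induction with
  | h_zero => rw [zero_mul, map_zero, zero_mul]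
  | h_add x y hx hy => rw [add_mul, map_add, hx, hy, map_add, add_mul]
  | h_smul s a =>
    rw [phi_smul_coe, smul_def, mul_assoc, ← smul_def]
    exact (phi_smul_coe s (a * b)).trans (smul_mul_assoc _ _ _).symm

theorem phiTensor_smul (s : Scalars n) (t : NilHecke n ⊗[Scalars n] NilHecke n) :
    phiTensor n (s • t) = evalZero n s • phiTensor n t := by
  induction t using tensor_span_induction with
  | h_zero => simp
  | h_add x y hx hy => rw [smul_add, map_add, hx, hy, map_add, smul_add]
  | h_smul s' a b =>
    rw [smul_smul, phiTensor_smul_coe, phiTensor_smul_coe, map_mul, smul_smul]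

theorem phiTensor_tensorMulRight (a b : nilCoxeter n) (t : NilHecke n ⊗[Scalars n] NilHecke n) :
    phiTensor n (tensorMulRight (a : NilHecke n) b t) = phiTensor n t * (a ⊗ₜ[ℤ] b) := by
  induction t using TensorProduct.induction_on with
  | zero => simp
  | add x y hx hy => rw [map_add, map_add, hx, hy, map_add, add_mul]
  | tmul x y =>
    rw [tensorMulRight_tmul, phiTensor_tmul, phi_mul_coe, phi_mul_coe, phiTensor_tmul,
      Algebra.TensorProduct.tmul_mul_tmul]

/-- The specialized coproduct `φ_0 ∘ Δ`. -/
noncomputable def coprodZero (n : ℕ) [n.AtLeastTwo] :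
    NilHecke n →+ nilCoxeter n ⊗[ℤ] nilCoxeter n :=
  (phiTensor n).comp (coprod n)

theorem coprodZero_apply (a : NilHecke n) : coprodZero n a = phiTensor n (coprod n a) := rfl

theorem coprodZero_smul (s : Scalars n) (a : NilHecke n) :
    coprodZero n (s • a) = evalZero n s • coprodZero n a := by
  rw [coprodZero_apply, coprod_smul, phiTensor_smul]; rfl

/-- Since `hLift n i` commutes with the scalars up to a rotation, its action on the tensor square
specializes at zero. -/
theorem phiTensor_coprodAct_hLift_smul {i : ℕ} (hi : i < n) (s : Scalars n)
    (t : NilHecke n ⊗[Scalars n] NilHecke n) :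
    phiTensor n (coprodAct n (hLift n i) (s • t)) =
      evalZero n s • phiTensor n (coprodAct n (hLift n i) t) := by
  induction s using SymmetricAlgebra.induction generalizing t with
  | algebraMap r => rw [algebraMap_smul, map_zsmul, map_zsmul, AlgHom.commutes]; rfl
  | ι l =>
    have : coprodAct n (hLift n i) (SymmetricAlgebra.ι ℤ (Weight n) l • t) =
        SymmetricAlgebra.ι ℤ (Weight n) (rotate n l) • coprodAct n (hLift n i) t := by
      have h1 := congrArg (fun a => coprodAct n a t) (hLift_mul_wt l hi)
      simp only [map_mul, ← scalar_ι] at h1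
      rw [← coprodAct_scalar, ← coprodAct_scalar]
      exact h1
    rw [this, phiTensor_smul, evalZero_ι, evalZero_ι, zero_smul]
  | mul a b ha hb => rw [mul_smul, ha, hb, map_mul, mul_smul]
  | add a b ha hb => rw [add_smul, map_add, map_add, ha, hb, map_add, add_smul]

/-- The action of `hLift n i` specializes to left multiplication by its specialized coproduct. -/
theorem phiTensor_coprodAct_hLift {i : ℕ} (hi : i < n)
    (t : NilHecke n ⊗[Scalars n] NilHecke n) :
    phiTensor n (coprodAct n (hLift n i) t) = coprodZero n (hLift n i) * phiTensor n t := by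
  induction t using tensor_span_induction with
  | h_zero => simp
  | h_add x y hx hy => rw [map_add, map_add, hx, hy, map_add, mul_add]
  | h_smul s a b =>
    rw [phiTensor_coprodAct_hLift_smul hi, coprodAct_tmul, phiTensor_tensorMulRight,
      phiTensor_smul_coe, mul_smul_comm]
    rfl

theorem coprodZero_h_mul {i : ℕ} (hi : i < n) (b : NilHecke n) :
    coprodZero n (h n i * b) = coprodZero n (h n i) * coprodZero n b := by
  have h1 := map_hLift ((coprodZero n).comp (AddMonoidHom.mulRight b)) (fun s a => by
    change coprodZero n (s • a * b) = evalZero n s • coprodZero n (a * b)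
    rw [smul_def, mul_assoc, ← smul_def, coprodZero_smul]) hi
  change coprodZero n (hLift n i * b) = coprodZero n (h n i * b) at h1
  rw [← h1, ← map_hLift (coprodZero n) coprodZero_smul hi, coprodZero_apply, coprod_mul,
    phiTensor_coprodAct_hLift hi, coprodZero_apply b]

theorem coprodZero_h {i : ℕ} (hi : i < n) : coprodZero n (h n i) =
    ∑ j : Fin (i + 1), phi n (h n j) ⊗ₜ[ℤ] phi n (h n (i - j)) := by
  rw [← map_hLift (coprodZero n) coprodZero_smul hi, coprodZero_apply, coprod_hLift hi, map_sum,
    Fin.sum_univ_eq_sum_range (fun j => phi n (h n j) ⊗ₜ[ℤ] phi n (h n (i - j))) (i + 1)]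
  have hin : ∀ j ∈ Finset.range n, phiTensor n (∑ k ∈ Finset.range n,
      powRed n (j + k) i • (hLift n j ⊗ₜ[Scalars n] hLift n k)) =
      if j ∈ Finset.range (i + 1) then phi n (h n j) ⊗ₜ[ℤ] phi n (h n (i - j)) else 0 := by
    intro j hj
    rw [map_sum, Finset.sum_congr rfl fun k hk => by
      rw [phiTensor_smul, phiTensor_tmul, evalZero_powRed _ hi,
        map_hLift (phi n) phi_smul (Finset.mem_range.1 hj),
        map_hLift (phi n) phi_smul (Finset.mem_range.1 hk)]]
    split_ifs with hji
    · rw [Finset.mem_range] at hji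
      rw [Finset.sum_eq_single (i - j)]
      · rw [if_pos (by omega), one_smul]
      · intro k _ hk
        rw [if_neg (by omega), zero_smul]
      · intro hk
        exact absurd (Finset.mem_range.2 (by omega)) hk
    · rw [Finset.mem_range] at hji
      refine Finset.sum_eq_zero fun k _ => ?_
      rw [if_neg (by omega), zero_smul]
  rw [Finset.sum_congr rfl hin, Finset.sum_ite_mem, Finset.inter_eq_right.2]
  exact Finset.range_subset_range.2 hi

theorem coprodZero_one : coprodZero n 1 = 1 := by
  rw [coprodZero_apply]
  change phiTensor n (coprodAct n 1 (1 ⊗ₜ[Scalars n] 1)) = _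
  have : phi n (1 : NilHecke n) = 1 := phi_coe 1
  rw [map_one, AddMonoid.End.one_apply, phiTensor_tmul, this]
  rfl

theorem coprodZero_mul_of_mem {a : NilHecke n} (ha : a ∈ fominStanley n) (b : NilHecke n) :
    coprodZero n (a * b) = coprodZero n a * coprodZero n b := by
  induction ha using Algebra.adjoin_induction generalizing b with
  | mem a ha =>
    obtain ⟨i, hi, rfl⟩ := ha
    exact coprodZero_h_mul hi b
  | algebraMap r =>
    rw [Algebra.algebraMap_eq_smul_one, smul_mul_assoc, one_mul, map_zsmul, map_zsmul,
      coprodZero_one, smul_mul_assoc, one_mul]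
  | add x y _ _ hx hy => rw [add_mul, map_add, hx, hy, map_add, add_mul]
  | mul x y _ _ hx hy => rw [mul_assoc, hx, hy, hx, mul_assoc]

/-- The specialized coproduct as a ring homomorphism on the affine Fomin-Stanley subalgebra. -/
noncomputable def coprodZeroHom (n : ℕ) [n.AtLeastTwo] :
    fominStanley n →+* nilCoxeter n ⊗[ℤ] nilCoxeter n where
  toFun b := coprodZero n b
  map_zero' := map_zero _
  map_one' := coprodZero_one
  map_add' _ _ := map_add _ _ _
  map_mul' a b := coprodZero_mul_of_mem a.2 b

theorem adjoin_hB : Algebra.adjoin ℤ {x : fominStanley n | ∃ (i : ℕ) (hi : i < n), x = hB i hi} =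
    ⊤ := by
  refine Eq.trans (congrArg _ ?_) (Algebra.adjoin_adjoin_coe_preimage (R := ℤ)
    (s := {x : NilHecke n | ∃ i < n, x = h n i}))
  ext x
  constructor
  · rintro ⟨i, hi, rfl⟩
    exact ⟨i, hi, rfl⟩
  · rintro ⟨i, hi, hx⟩
    exact ⟨i, hi, Subtype.ext hx⟩

/-- A ring homomorphism from the affine Fomin-Stanley subalgebra is determined by the `h_i`. -/
theorem fominStanley_hom_ext {R : Type*} [Ring R] {f g : fominStanley n →+* R}
    (hfg : ∀ i (hi : i < n), f (hB i hi) = g (hB i hi)) : f = g := by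
  have key : f.toIntAlgHom = g.toIntAlgHom := by
    refine AlgHom.ext_of_adjoin_eq_top adjoin_hB ?_
    rintro _ ⟨i, hi, rfl⟩
    exact hfg i hi
  ext x
  exact DFunLike.congr_fun key x

instance : CharZero (Scalars n) where
  cast_injective a b hab := by
    have := congrArg (evalZero n) hab
    simpa using this

instance : IsAddTorsionFree (NilHecke n) := .of_isTorsionFree (Scalars n) _

theorem inclTensor_tmul (a b : fominStanley n) : inclTensor n (a ⊗ₜ[ℤ] b) =
    Subalgebra.inclusion (fominStanley_le n) a ⊗ₜ[ℤ]
      Subalgebra.inclusion (fominStanley_le n) b :=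
  rfl

/-- The affine Fomin-Stanley subalgebra is torsion-free, hence flat, over `ℤ`. -/
theorem inclTensor_injective : Function.Injective (inclTensor n) :=
  TensorProduct.map_injective_of_flat_flat_of_isDomain
    (Subalgebra.inclusion (fominStanley_le n)).toLinearMap
    (Subalgebra.inclusion (fominStanley_le n)).toLinearMap
    (Subalgebra.inclusion_injective (fominStanley_le n))
    (Subalgebra.inclusion_injective (fominStanley_le n))

theorem phi_h {i : ℕ} (hi : i < n) :
    phi n (h n i) = Subalgebra.inclusion (fominStanley_le n) (hB i hi) :=
  phi_coe (Subalgebra.inclusion (fominStanley_le n) (hB i hi))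

theorem coprodZeroHom_hB {i : ℕ} (hi : i < n) : coprodZeroHom n (hB i hi) =
    inclTensor n (∑ j : Fin (i + 1), hB (j : ℕ) (by omega) ⊗ₜ[ℤ] hB (i - j : ℕ) (by omega)) := by
  refine (coprodZero_h hi).trans ?_
  rw [map_sum]
  refine Finset.sum_congr rfl fun j _ => ?_
  rw [inclTensor_tmul, phi_h, phi_h]

/-- Along the inclusion of `B ⊗ B`, a symmetric function coproduct is the specialized coproduct. -/
theorem inclTensor_comp {D : fominStanley n →+* fominStanley n ⊗[ℤ] fominStanley n}
    (hD : IsSymmetricCoproduct D) : (inclTensor n).comp D = coprodZeroHom n :=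
  fominStanley_hom_ext fun i hi => by
    rw [coprodZeroHom_hB, ← hD i hi]; rfl

/-- The specialized coproduct takes its values in `B ⊗ B`, as it does so on the `h_i`. -/
theorem coprodZeroHom_mem_range (b : fominStanley n) :
    coprodZeroHom n b ∈ (inclTensor n).range := by
  have hle : Algebra.adjoin ℤ {x : fominStanley n | ∃ (i : ℕ) (hi : i < n), x = hB i hi} ≤
      ((inclTensor n).toIntAlgHom.range).comap (coprodZeroHom n).toIntAlgHom := by
    refine Algebra.adjoin_le ?_
    rintro _ ⟨i, hi, rfl⟩
    exact ⟨_, (coprodZeroHom_hB hi).symm⟩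
  rw [adjoin_hB] at hle
  exact hle (Algebra.mem_top (x := b))

/-- The symmetric function coproduct, obtained by restricting the codomain of the specialized
coproduct to `B ⊗ B`. -/
noncomputable def fominStanleyCoprod (n : ℕ) [n.AtLeastTwo] :
    fominStanley n →+* fominStanley n ⊗[ℤ] fominStanley n :=
  (RingEquiv.ofLeftInverse
    (Function.leftInverse_invFun (inclTensor_injective (n := n)))).symm.toRingHom.comp
    ((coprodZeroHom n).codRestrict (inclTensor n).range coprodZeroHom_mem_range)

theorem inclTensor_fominStanleyCoprod (b : fominStanley n) :
    inclTensor n (fominStanleyCoprod n b) = coprodZeroHom n b :=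
  congrArg Subtype.val ((RingEquiv.ofLeftInverse
    (Function.leftInverse_invFun (inclTensor_injective (n := n)))).apply_symm_apply
      ⟨coprodZeroHom n b, coprodZeroHom_mem_range b⟩)

theorem isSymmetricCoproduct_fominStanleyCoprod : IsSymmetricCoproduct (fominStanleyCoprod n) :=
  fun i hi => inclTensor_injective
    ((inclTensor_fominStanleyCoprod (hB i hi)).trans (coprodZeroHom_hB hi))

end

end AffineFS

theorem mainTheorem5 (n : ℕ) [n.AtLeastTwo] :
    (∃! D : AffineFS.fominStanley n →+* AffineFS.fominStanley n ⊗[ℤ] AffineFS.fominStanley n,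
      AffineFS.IsSymmetricCoproduct D) ∧
    ∀ D : AffineFS.fominStanley n →+* AffineFS.fominStanley n ⊗[ℤ] AffineFS.fominStanley n,
      AffineFS.IsSymmetricCoproduct D →
      ∀ b : AffineFS.fominStanley n,
        AffineFS.phiTensor n (AffineFS.coprod n (b : AffineFS.NilHecke n)) =
          AffineFS.inclTensor n (D b) := by
  open AffineFS in
  refine ⟨⟨fominStanleyCoprod n, isSymmetricCoproduct_fominStanleyCoprod, fun D hD => ?_⟩,
    fun D hD b => (DFunLike.congr_fun (inclTensor_comp hD) b).symm⟩
  exact fominStanley_hom_ext fun i hi =>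
    (hD i hi).trans (isSymmetricCoproduct_fominStanleyCoprod i hi).symm
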